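/- Let $d\ge 1$, $\alpha>0$, and let $\phi\in\mathcal S(\mathbb R^d)$ be a nonzero window whose Fourier transform is supported in an annulus $\{R_1\le|\zeta|\le R_2\}$ for some $0<R_1<R_2<\infty$. For $x\in\mathbb R^d$ and $\xi\in\mathbb R^d\setminus\{0\}$ put $$\phi_{x,\xi}(t)=|\xi|^{\frac d2(1-\alpha)}\,\phi\big((t-x)|\xi|^{1-\alpha}\big)\,e^{it\cdot\xi},\qquad s(\xi)=\max(1,|\xi|)^{1-\alpha},$$ and, for $\rho>0$, $Q(x,\xi;\rho)=\{(y,\eta):|y-x|\le\rho\,s(\xi)^{-1},\ |\eta-\xi|\le\rho\,s(\xi)\}$. A subdyadic lattice of mesh $\rho$ is a family $\Omega_\alpha=\{(x_j^k,\xi_k)\}_{k\in\mathbb N,\,j\in\mathbb Z^d}\subset\mathbb R^d\times(\mathbb R^d\setminus\{0\})$ such that: the balls $\{\eta:|\eta-\xi_k|\le\rho\,s(\xi_k)\}$ cover $\mathbb R^d$; for each $k$ the balls $\{y:|y-x_j^k|\le\rho\,s(\xi_k)^{-1}\}$, $j\in\mathbb Z^d$, cover $\mathbb R^d$; and there is $N_0<\infty$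 such that every $(y,\eta)\in\mathbb R^{2d}$ lies in $Q(x_j^k,\xi_k;\rho)$ for at most $N_0$ pairs $(j,k)$. For $f\in\mathcal S'(\mathbb R^d)$ let $c_{j,k}(f)=\langle f,\phi_{x_j^k,\xi_k}\rangle$ (the pairing being conjugate-linear in the second argument) and, for $1\le p,q\le\infty$ and $\beta\in\mathbb R$, $$\|f\|_{M^{p,q}_{\alpha,\beta}}=\Big(\sum_k\Big(\sum_{j\in\mathbb Z^d}|c_{j,k}(f)|^p\Big)^{q/p}(1+|\xi_k|)^{\beta q}\Big)^{1/q}\in[0,\infty]$$ (with suprema for infinite exponents), and let $M^{p,q}_{\alpha,\beta}$ be the set of $f\in\mathcal S'(\mathbb R^d)$ for which this is finite. **Proposition.** There is $\rho_0>0$, depending only on $d$, $\alpha$ and $\phi$, such that for every $\rho\in(0,\rho_0]$ and every subdyadic lattice $\Omega_\alpha$ of mesh $\rho$, $M^{2,2}_{\alpha,0}=L^2(\mathbb R^d)$ as subsets of $\mathcal S'(\mathbb R^d)$, with equivalent norms: there exist $0<A\le B<\infty$ such that $$A\,\|f\|_{L^2}^2\ \le\ \|f\|_{M^{2,2}_{\alpha,0}}^2\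 \le\ B\,\|f\|_{L^2}^2,\qquad f\in L^2(\mathbb R^d).$$ -/

import Mathlib

open MeasureTheory Complex
open scoped SchwartzMap ENNReal FourierTransform ComplexConjugate

noncomputable section

namespace Subdyadic

/-- Complex conjugation of Schwartz functions. -/
def conjS {d : ℕ} (φ : 𝓢(EuclideanSpace ℝ (Fin d), ℂ)) : 𝓢(EuclideanSpace ℝ (Fin d), ℂ) :=
  SchwartzMap.postcompCLM (𝕜 := ℝ) (conjCLE : ℂ →L[ℝ] ℂ) φ

theorem conjS_apply {d : ℕ} (φ : 𝓢(EuclideanSpace ℝ (Fin d), ℂ))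
    (t : EuclideanSpace ℝ (Fin d)) : conjS φ t = conj (φ t) := rfl

theorem hasTemperateGrowth_cexp_ofReal_mul_I :
    (fun s : ℝ => cexp ((s : ℂ) * I)).HasTemperateGrowth := by
  have hderiv : ∀ n : ℕ, iteratedDeriv n (fun s : ℝ => cexp ((s : ℂ) * I))
      = fun s : ℝ => I ^ n * cexp ((s : ℂ) * I) := by
    intro n
    induction n with
    | zero => simp
    | succ n ih =>
      rw [iteratedDeriv_succ, ih]
      funext s
      have h1 : HasDerivAt (fun s : ℝ => (s : ℂ) * I) (1 * I) s :=
        (Complex.ofRealCLM.hasDerivAt).mul_const I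
      have h2 := (h1.cexp).const_mul (I ^ n)
      rw [h2.deriv]
      ring
  have hsmooth : ContDiff ℝ (⊤ : ℕ∞) (fun s : ℝ => cexp ((s : ℂ) * I)) :=
    (Complex.ofRealCLM.contDiff.mul contDiff_const).cexp
  refine ⟨hsmooth, fun n => ⟨0, 1, fun s => ?_⟩⟩
  rw [norm_iteratedFDeriv_eq_norm_iteratedDeriv, hderiv]
  simp [Complex.norm_exp_ofReal_mul_I]

/-- The character `t ↦ exp (i t·ξ)` has temperate growth. -/
theorem hasTemperateGrowth_character {d : ℕ} (ξ : EuclideanSpace ℝ (Fin d)) :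
    (fun t : EuclideanSpace ℝ (Fin d) =>
      cexp (((inner ℝ t ξ : ℝ) : ℂ) * I)).HasTemperateGrowth := by
  have h : (fun t : EuclideanSpace ℝ (Fin d) => (inner ℝ t ξ : ℝ)).HasTemperateGrowth :=
    ((innerSL ℝ).flip ξ).hasTemperateGrowth
  exact hasTemperateGrowth_cexp_ofReal_mul_I.comp h

/-- The factor `|ξ|^(1-α)` as a unit of `ℝ`, for `ξ ≠ 0`. -/
def dilationFactor {d : ℕ} (α : ℝ) (ξ : EuclideanSpace ℝ (Fin d)) (hξ : ξ ≠ 0) : ℝˣ :=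
  Units.mk0 (‖ξ‖ ^ (1 - α)) (Real.rpow_pos_of_pos (norm_pos_iff.mpr hξ) _).ne'

/-- The dispersive wave packet
`φ_{x,ξ}(t) = |ξ|^{(d/2)(1-α)} φ((t - x) |ξ|^{1-α}) e^{i t·ξ}`, as a Schwartz function;
see `packet_apply` for the formula. -/
def packet {d : ℕ} (α : ℝ) (φ : 𝓢(EuclideanSpace ℝ (Fin d), ℂ))
    (x ξ : EuclideanSpace ℝ (Fin d)) (hξ : ξ ≠ 0) : 𝓢(EuclideanSpace ℝ (Fin d), ℂ) :=
  (((‖ξ‖ ^ ((d : ℝ) / 2 * (1 - α)) : ℝ)) : ℂ) •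
    SchwartzMap.smulLeftCLM ℂ
      (fun t : EuclideanSpace ℝ (Fin d) => cexp (((inner ℝ t ξ : ℝ) : ℂ) * I))
      (SchwartzMap.compSubConstCLM ℂ x
        (SchwartzMap.compCLMOfContinuousLinearEquiv ℂ
          (ContinuousLinearEquiv.smulLeft (R₁ := ℝ) (M₁ := EuclideanSpace ℝ (Fin d))
            (dilationFactor α ξ hξ)) φ))

theorem packet_apply {d : ℕ} (α : ℝ) (φ : 𝓢(EuclideanSpace ℝ (Fin d), ℂ))
    (x ξ : EuclideanSpace ℝ (Fin d)) (hξ : ξ ≠ 0) (t : EuclideanSpace ℝ (Fin d)) :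
    packet α φ x ξ hξ t =
      ((‖ξ‖ ^ ((d : ℝ) / 2 * (1 - α)) : ℝ) : ℂ) * φ ((‖ξ‖ ^ (1 - α)) • (t - x)) *
        cexp (((inner ℝ t ξ : ℝ) : ℂ) * I) := by
  simp only [packet, smul_apply,
    SchwartzMap.smulLeftCLM_apply_apply (hasTemperateGrowth_character ξ),
    SchwartzMap.compSubConstCLM_apply, SchwartzMap.compCLMOfContinuousLinearEquiv_apply,
    Function.comp_apply, smul_eq_mul]
  have : (ContinuousLinearEquiv.smulLeft (R₁ := ℝ) (M₁ := EuclideanSpace ℝ (Fin d))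
      (dilationFactor α ξ hξ)) (t - x) = (‖ξ‖ ^ (1 - α)) • (t - x) := rfl
  rw [this]
  ring

/-- The window class: nonzero Schwartz functions whose Fourier transform is supported in an
annulus `R₁ ≤ |ζ| ≤ R₂` with `0 < R₁ < R₂ < ∞`. Since the radii are free, the normalization of
the Fourier transform plays no role. -/
structure IsWindow {d : ℕ} (φ : 𝓢(EuclideanSpace ℝ (Fin d), ℂ)) : Prop where
  ne_zero : φ ≠ 0
  annulus : ∃ R₁ R₂ : ℝ, 0 < R₁ ∧ R₁ < R₂ ∧
    ∀ ζ : EuclideanSpace ℝ (Fin d), (𝓕 φ) ζ ≠ 0 → R₁ ≤ ‖ζ‖ ∧ ‖ζ‖ ≤ R₂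

/-- The subdyadic frequency scale: `|ξ|^(1-α)` for `|ξ| ≥ 1`, and `1` for `|ξ| ≤ 1`. -/
def scale {d : ℕ} (α : ℝ) (ξ : EuclideanSpace ℝ (Fin d)) : ℝ := (max 1 ‖ξ‖) ^ (1 - α)

/-- The phase-space block of size `ρ` centred at `(x, ξ)`. For `|ξ| ≥ 1` it is
`{(y, η) : |y - x| ≤ ρ |ξ|^(α-1), |η - ξ| ≤ ρ |ξ|^(1-α)}`; for low frequencies `|ξ| ≤ 1`
both radii are `ρ`. -/
def block {d : ℕ} (α ρ : ℝ) (x ξ : EuclideanSpace ℝ (Fin d)) :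
    Set (EuclideanSpace ℝ (Fin d) × EuclideanSpace ℝ (Fin d)) :=
  {z | ‖z.1 - x‖ ≤ ρ * (scale α ξ)⁻¹ ∧ ‖z.2 - ξ‖ ≤ ρ * scale α ξ}

/-- A subdyadic lattice `Ω_α = {(x_j^k, ξ_k) : k ∈ ℕ, j ∈ ℤ^d}` of mesh `ρ` in
`ℝ^d × (ℝ^d ∖ {0})`: the frequency balls of radius `ρ · scale` around the `ξ_k` cover the
frequency space (low frequencies included), for each `k` the spatial points `x_j^k` form a net
of mesh `ρ / scale`, and the blocks have finite overlap. In particular the blocks cover phase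
space. -/
structure Lattice (d : ℕ) (α ρ : ℝ) where
  /-- the frequency centres `ξ_k` -/
  freq : ℕ → EuclideanSpace ℝ (Fin d)
  /-- the spatial centres `x_j^k` -/
  pos : ℕ → (Fin d → ℤ) → EuclideanSpace ℝ (Fin d)
  freq_ne_zero : ∀ k, freq k ≠ 0
  freq_cover : ∀ η : EuclideanSpace ℝ (Fin d), ∃ k, ‖η - freq k‖ ≤ ρ * scale α (freq k)
  pos_cover : ∀ (k : ℕ) (y : EuclideanSpace ℝ (Fin d)),
    ∃ j, ‖y - pos k j‖ ≤ ρ * (scale α (freq k))⁻¹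
  finite_overlap : ∃ N₀ : ℕ, ∀ z : EuclideanSpace ℝ (Fin d) × EuclideanSpace ℝ (Fin d),
    {p : ℕ × (Fin d → ℤ) | z ∈ block α ρ (pos p.1 p.2) (freq p.1)}.encard ≤ N₀

/-- The `ℓ^p` norm of a family in `[0, ∞]`, for `1 ≤ p ≤ ∞`. -/
def ellNorm {ι : Type*} (p : ℝ≥0∞) (c : ι → ℝ≥0∞) : ℝ≥0∞ :=
  if p = ∞ then ⨆ i, c i else (∑' i, c i ^ p.toReal) ^ (1 / p.toReal)

/-- The dispersive Gabor coefficient `c_{j,k}(f) = ⟨f, φ_{x_j^k, ξ_k}⟩` of a tempered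
distribution; the pairing extends `∫ f(t) conj(g(t)) dt`. -/
def coeff {d : ℕ} {α ρ : ℝ} (φ : 𝓢(EuclideanSpace ℝ (Fin d), ℂ)) (Ω : Lattice d α ρ)
    (f : 𝓢'(EuclideanSpace ℝ (Fin d), ℂ)) (k : ℕ) (j : Fin d → ℤ) : ℂ :=
  f (conjS (packet α φ (Ω.pos k j) (Ω.freq k) (Ω.freq_ne_zero k)))

/-- The norm (with values in `[0, ∞]`) of the dispersive modulation space `M^{p,q}_{α,β}`. -/
def modNorm {d : ℕ} {α ρ : ℝ} (φ : 𝓢(EuclideanSpace ℝ (Fin d), ℂ)) (Ω : Lattice d α ρ)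
    (p q : ℝ≥0∞) (β : ℝ) (f : 𝓢'(EuclideanSpace ℝ (Fin d), ℂ)) : ℝ≥0∞ :=
  ellNorm q fun k : ℕ =>
    ellNorm p (fun j : Fin d → ℤ => ‖coeff φ Ω f k j‖ₑ) *
      ENNReal.ofReal ((1 + ‖Ω.freq k‖) ^ β)

/-- The dispersive modulation space `M^{p,q}_{α,β}`, a set of tempered distributions. -/
def modSpace {d : ℕ} {α ρ : ℝ} (φ : 𝓢(EuclideanSpace ℝ (Fin d), ℂ)) (Ω : Lattice d α ρ)
    (p q : ℝ≥0∞) (β : ℝ) : Set 𝓢'(EuclideanSpace ℝ (Fin d), ℂ) :=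
  {f | modNorm φ Ω p q β f < ∞}

end Subdyadic

end

open MeasureTheory Complex
open scoped SchwartzMap ENNReal FourierTransform ComplexConjugate

noncomputable section

set_option linter.unusedSectionVars false

namespace Subdyadic

/-! Fix a frequency centre `ξ`, put `a = |ξ|^(1-α)`, and let `P` be the conjugated packet at
position `0`. Up to unimodular phases, the coefficients at `ξ` are the samples at the spatial
centres of one function `F(x) = ⟨f, P(· - x)⟩`, whose frequencies lie in a ball of radius
proportional to `a`. The statement therefore splits into a sampling problem for each `ξ_k` and a
covering problem in frequency.

Sampling: a band-limited function is reproduced by convolution with an `L¹`-normalized kernel at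
scale `1/a`, so its oscillation over distances `L/a` has `L²` norm at most `κ(L)` times its own,
with `κ(L) = C L (1+L)^(d+1)`. Bounded overlap of the sampling balls then bounds the samples by
`‖F‖₂`. When `κ(L) ≤ 1/2`, the oscillation can be absorbed and the samples on a net bound `‖F‖₂`.
For tempered `f` the function `F` only has polynomial growth, so absorption is carried out on `q_n
F`, with Schwartz cutoffs `q_n` that barely enlarge the band, and `n` is sent to infinity
(`exists_sampling`).

Upper bound: Plancherel turns `a^d ‖F‖₂²` into `∫ |𝓕f|² |𝓕φ|²`, with `𝓕φ` rescaled to `ξ_k`. At high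
frequency boundedly many of these windows overlap, by a volume count which uses that `α > 0` makes
the radii `|ξ|^(1-α)` small relative to `|ξ|`. Only finitely many centres remain
(`exists_modNorm_schwartz_le`), and density gives all of `L²`.

Lower bound: with `𝓕φ(ζ₀) ≠ 0`, the equation `|η - t^(1-α) ζ| = t`, `ζ` near `ζ₀`, produces `ξ = η -
t^(1-α) ζ` whose window takes the value at `ζ`. A fine lattice has a centre near this `ξ`, so every
`η` is seen by some packet (`exists_frequency_cover`). Dividing by the sum of squared windows writes
a band-limited test function as a finite sum of convolutions with the `P_k`. Cauchy-Schwarz bounds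
`f` on it by the modulation norm (`enorm_apply_sq_le`). By density and Riesz representation `f` is
in `L²`, with the lower inequality (`exists_lp_of_bound`, `exists_le_modNorm`). -/

theorem ennreal_add_sq_le (a b : ℝ≥0∞) : (a + b) ^ 2 ≤ 2 * a ^ 2 + 2 * b ^ 2 := by
  have h := ENNReal.rpow_add_le_mul_rpow_add_rpow a b (p := 2) (by norm_num)
  have e : (2 : ℝ≥0∞) ^ ((2 : ℝ) - 1) = 2 := by norm_num
  rw [e, mul_add] at h
  exact_mod_cast h

theorem tsum_indicator_closedBall {ι E : Type*} [SeminormedAddCommGroup E] (x : ι → E) (δ : ℝ) (y : E) (c : ℝ≥0∞) :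
    ∑' j, (Metric.closedBall (x j) δ).indicator (fun _ => c) y =
      ({j | ‖y - x j‖ ≤ δ}.encard : ℝ≥0∞) * c := by
  have : ∀ j, (Metric.closedBall (x j) δ).indicator (fun _ => c) y =
      {j | ‖y - x j‖ ≤ δ}.indicator (fun _ => (1 : ℝ≥0∞)) j * c := by
    intro j
    by_cases h : ‖y - x j‖ ≤ δ <;> simp [Set.indicator, h, dist_eq_norm]
  simp_rw [this]
  rw [ENNReal.tsum_mul_right, ← tsum_subtype, ENNReal.tsum_set_one]

/-! ### Abstract sampling inequalities in terms of local oscillation -/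

section Sampling

variable {E : Type*} [NormedAddCommGroup E] [NormedSpace ℝ E] [FiniteDimensional ℝ E]
  [MeasurableSpace E] [BorelSpace E] (μ : Measure E) [μ.IsAddHaarMeasure]

/-- Young's inequality `‖f ⋆ h‖₂ ≤ ‖h‖₁ ‖f‖₂` for nonnegative functions. -/
theorem lintegral_conv_sq_le {f h : E → ℝ≥0∞} (hf : Measurable f) (hh : Measurable h) :
    ∫⁻ y, (∫⁻ z, f z * h (y - z) ∂μ) ^ 2 ∂μ ≤ (∫⁻ z, h z ∂μ) ^ 2 * ∫⁻ z, f z ^ 2 ∂μ := by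
  have hsub : ∀ y, ∫⁻ z, h (y - z) ∂μ = ∫⁻ z, h z ∂μ := fun y =>
    lintegral_sub_left_eq_self h y
  have hsub' : ∀ z, ∫⁻ y, h (y - z) ∂μ = ∫⁻ z, h z ∂μ := fun z =>
    lintegral_sub_right_eq_self h z
  have key : ∀ y, (∫⁻ z, f z * h (y - z) ∂μ) ^ 2 ≤
      (∫⁻ z, f z ^ 2 * h (y - z) ∂μ) * ∫⁻ z, h z ∂μ := by
    intro y
    have hm : Measurable fun z => h (y - z) := hh.comp (measurable_const.sub measurable_id)
    have h1 := ENNReal.lintegral_mul_le_Lp_mul_Lq μ (p := 2) (q := 2)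
      (Real.HolderConjugate.two_two)
      (f := fun z => f z * h (y - z) ^ (1 / 2 : ℝ)) (g := fun z => h (y - z) ^ (1 / 2 : ℝ))
      ((hf.mul (hm.pow_const _)).aemeasurable) ((hm.pow_const _).aemeasurable)
    have e1 : ∀ z, ((fun z => f z * h (y - z) ^ (1 / 2 : ℝ)) *
        fun z => h (y - z) ^ (1 / 2 : ℝ)) z = f z * h (y - z) := by
      intro z
      simp only [Pi.mul_apply, mul_assoc]
      rw [← ENNReal.rpow_add_of_nonneg _ _ (by norm_num) (by norm_num)]
      norm_num
    have e2 : ∀ z, (f z * h (y - z) ^ (1 / 2 : ℝ)) ^ (2 : ℝ) = f z ^ 2 * h (y - z) := by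
      intro z
      rw [ENNReal.mul_rpow_of_nonneg _ _ (by norm_num), ← ENNReal.rpow_mul]
      norm_num
    have e3 : ∀ z, (h (y - z) ^ (1 / 2 : ℝ)) ^ (2 : ℝ) = h (y - z) := by
      intro z
      rw [← ENNReal.rpow_mul]
      norm_num
    simp only [e1, e2, e3, hsub] at h1
    calc _ ≤ _ := pow_le_pow_left₀ (zero_le) h1 2
      _ = _ := by
        rw [mul_pow, ← ENNReal.rpow_natCast, ← ENNReal.rpow_natCast, ← ENNReal.rpow_mul,
          ← ENNReal.rpow_mul]
        norm_num
  calc _ ≤ ∫⁻ y, (∫⁻ z, f z ^ 2 * h (y - z) ∂μ) * ∫⁻ z, h z ∂μ ∂μ := lintegral_mono key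
    _ = (∫⁻ y, (∫⁻ z, f z ^ 2 * h (y - z) ∂μ) ∂μ) * ∫⁻ z, h z ∂μ := by
      apply lintegral_mul_const
      apply Measurable.lintegral_prod_right' (f := fun p : E × E => f p.2 ^ 2 * h (p.1 - p.2))
      fun_prop
    _ = (∫⁻ z, (∫⁻ y, f z ^ 2 * h (y - z) ∂μ) ∂μ) * ∫⁻ z, h z ∂μ := by
      rw [lintegral_lintegral_swap]
      refine Measurable.aemeasurable ?_
      simp only [Function.uncurry_def]
      fun_prop
    _ = (∫⁻ z, f z ^ 2 * (∫⁻ z, h z ∂μ) ∂μ) * ∫⁻ z, h z ∂μ := by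
      congr 2 with z
      rw [lintegral_const_mul _ (by fun_prop), hsub']
    _ = _ := by
      rw [lintegral_mul_const _ (hf.pow_const _)]
      ring

variable {ι : Type*} [Countable ι]

/-- Sampling on a family of points whose `δ`-balls have bounded overlap is bounded by the `L²`
norms of the function and of its local oscillation. -/
theorem tsum_sample_sq_le {x : ι → E} {δ : ℝ} {N : ℕ}
    (hN : ∀ y, {j | ‖y - x j‖ ≤ δ}.encard ≤ N) {F : E → ℂ} (hF : Measurable F)
    {G : E → ℝ≥0∞} (hG : Measurable G)
    (h : ∀ x y, ‖x - y‖ ≤ δ → ‖F x‖ₑ ≤ ‖F y‖ₑ + G y) :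
    μ (Metric.closedBall 0 δ) * ∑' j, ‖F (x j)‖ₑ ^ 2 ≤
      N * (2 * ∫⁻ y, ‖F y‖ₑ ^ 2 ∂μ + 2 * ∫⁻ y, G y ^ 2 ∂μ) := by
  have hFm : Measurable fun y => ‖F y‖ₑ := hF.enorm
  calc μ (Metric.closedBall 0 δ) * ∑' j, ‖F (x j)‖ₑ ^ 2
      = ∑' j, ∫⁻ y, (Metric.closedBall (x j) δ).indicator (fun _ => ‖F (x j)‖ₑ ^ 2) y ∂μ := by
        rw [← ENNReal.tsum_mul_left]
        congr 1 with j
        rw [lintegral_indicator_const Metric.isClosed_closedBall.measurableSet,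
          Measure.addHaar_closedBall_center μ (x j), mul_comm]
    _ = ∫⁻ y, ∑' j, (Metric.closedBall (x j) δ).indicator (fun _ => ‖F (x j)‖ₑ ^ 2) y ∂μ := by
        rw [lintegral_tsum]
        intro j
        exact (measurable_const.indicator Metric.isClosed_closedBall.measurableSet).aemeasurable
    _ ≤ ∫⁻ y, ∑' j, (Metric.closedBall (x j) δ).indicator
          (fun _ => 2 * ‖F y‖ₑ ^ 2 + 2 * G y ^ 2) y ∂μ := by
        refine lintegral_mono fun y => ENNReal.tsum_le_tsum fun j => ?_
        by_cases hy : y ∈ Metric.closedBall (x j) δ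
        · simp only [Set.indicator_of_mem hy]
          refine le_trans (pow_le_pow_left₀ zero_le (h (x j) y ?_) 2) (ennreal_add_sq_le _ _)
          rwa [← dist_eq_norm, dist_comm]
        · simp [hy]
    _ ≤ ∫⁻ y, N * (2 * ‖F y‖ₑ ^ 2 + 2 * G y ^ 2) ∂μ := by
        refine lintegral_mono fun y => ?_
        rw [tsum_indicator_closedBall]
        gcongr
        exact (ENat.toENNReal_mono (hN y)).trans (by simp)
    _ = _ := by
        rw [lintegral_const_mul _ (by fun_prop), lintegral_add_left (by fun_prop),
          lintegral_const_mul _ (by fun_prop), lintegral_const_mul _ (by fun_prop)]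

/-- The `L²` norm of a function is controlled by its samples on a `δ`-net and by the `L²` norm
of its local oscillation. -/
theorem lintegral_sq_le_tsum_sample {x : ι → E} {δ : ℝ}
    (hcov : ∀ y, ∃ j, ‖y - x j‖ ≤ δ) {F : E → ℂ}
    {G : E → ℝ≥0∞} (hG : Measurable G)
    (h : ∀ x y, ‖x - y‖ ≤ δ → ‖F y‖ₑ ≤ ‖F x‖ₑ + G y) :
    ∫⁻ y, ‖F y‖ₑ ^ 2 ∂μ ≤
      2 * (μ (Metric.closedBall 0 δ) * ∑' j, ‖F (x j)‖ₑ ^ 2) + 2 * ∫⁻ y, G y ^ 2 ∂μ := by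
  calc ∫⁻ y, ‖F y‖ₑ ^ 2 ∂μ
      ≤ ∫⁻ y, (2 * ∑' j, (Metric.closedBall (x j) δ).indicator (fun _ => ‖F (x j)‖ₑ ^ 2) y +
          2 * G y ^ 2) ∂μ := by
        refine lintegral_mono fun y => ?_
        obtain ⟨j, hj⟩ := hcov y
        refine le_trans (pow_le_pow_left₀ zero_le
          (h (x j) y (by rwa [norm_sub_rev])) 2) ((ennreal_add_sq_le _ _).trans ?_)
        gcongr
        refine le_trans ?_ (ENNReal.le_tsum j)
        rw [Set.indicator_of_mem]
        rwa [Metric.mem_closedBall, dist_eq_norm]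
    _ = _ := by
        rw [lintegral_add_right _ (by fun_prop), lintegral_const_mul _ (hG.pow_const 2)]
        congr 1
        rw [lintegral_const_mul, lintegral_tsum]
        · congr 1
          rw [← ENNReal.tsum_mul_left]
          refine tsum_congr fun j => ?_
          rw [lintegral_indicator_const Metric.isClosed_closedBall.measurableSet,
            Measure.addHaar_closedBall_center μ (x j), mul_comm]
        · intro j
          exact (measurable_const.indicator Metric.isClosed_closedBall.measurableSet).aemeasurable
        · exact Measurable.tsum fun j =>
            measurable_const.indicator Metric.isClosed_closedBall.measurableSet

end Sampling

/-! ### Translates of Schwartz functions -/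

section Translation

theorem one_add_norm_le_mul {E : Type*} [SeminormedAddCommGroup E] (x y : E) : 1 + ‖x‖ ≤ (1 + ‖y‖) * (1 + ‖x - y‖) := by
  have h := norm_sub_norm_le x y
  nlinarith [norm_nonneg y, norm_nonneg (x - y)]

variable {E V : Type*} [NormedAddCommGroup E] [NormedSpace ℝ E]
  [NormedAddCommGroup V] [NormedSpace ℝ V]

theorem exists_one_add_norm_pow_mul_le (P : 𝓢(E, V)) (M n : ℕ) :
    ∃ C, 0 ≤ C ∧ ∀ x, (1 + ‖x‖) ^ M * ‖iteratedFDeriv ℝ n P x‖ ≤ C :=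
  ⟨_, by positivity, fun x => SchwartzMap.one_add_le_sup_seminorm_apply (𝕜 := ℝ) (m := (M, n))
    le_rfl le_rfl P x⟩

/-- Weighted Lipschitz estimate for the derivatives of a Schwartz function. -/
theorem exists_norm_iteratedFDeriv_sub_le (P : 𝓢(E, V)) (M n : ℕ) :
    ∃ C, 0 ≤ C ∧ ∀ x y, (1 + ‖y‖) ^ M * ‖iteratedFDeriv ℝ n P x - iteratedFDeriv ℝ n P y‖ ≤
      C * ‖x - y‖ * (1 + ‖x - y‖) ^ M := by
  obtain ⟨C, hC, h⟩ := exists_one_add_norm_pow_mul_le P M (n + 1)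
  refine ⟨C, hC, fun x y => ?_⟩
  have hpos : 0 < (1 + ‖y‖) ^ M := by positivity
  have hseg : ‖iteratedFDeriv ℝ n P x - iteratedFDeriv ℝ n P y‖ ≤
      (C * (1 + ‖x - y‖) ^ M / (1 + ‖y‖) ^ M) * ‖x - y‖ := by
    refine (convex_segment y x).norm_image_sub_le_of_norm_fderiv_le (𝕜 := ℝ)
      (f := iteratedFDeriv ℝ n P) (fun s _ => ?_) (fun s hs => ?_)
      (left_mem_segment ℝ y x) (right_mem_segment ℝ y x)
    · exact ((P.smooth ⊤).differentiable_iteratedFDeriv (m := n)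
        (by exact_mod_cast ENat.natCast_lt_top n)) s
    · rw [norm_fderiv_iteratedFDeriv, le_div_iff₀ hpos]
      have h1 : ‖y - s‖ ≤ ‖x - y‖ := by
        obtain ⟨a, b, ha, hb, hab, rfl⟩ := hs
        have : y - (a • y + b • x) = b • (y - x) := by
          rw [smul_sub]
          nth_rewrite 1 [← one_smul ℝ y]
          rw [← hab, add_smul]
          abel
        rw [this, norm_smul, Real.norm_of_nonneg hb, norm_sub_rev x y]
        nlinarith [norm_nonneg (y - x)]
      -- Along the segment the weight at `y` is exchanged for the weight at `s`, where the decay of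
      -- the next derivative is available.
      have h2 : 1 + ‖y‖ ≤ (1 + ‖s‖) * (1 + ‖x - y‖) :=
        (one_add_norm_le_mul y s).trans (by gcongr)
      calc ‖iteratedFDeriv ℝ (n + 1) P s‖ * (1 + ‖y‖) ^ M
          ≤ ‖iteratedFDeriv ℝ (n + 1) P s‖ * ((1 + ‖s‖) * (1 + ‖x - y‖)) ^ M := by gcongr
        _ = ((1 + ‖s‖) ^ M * ‖iteratedFDeriv ℝ (n + 1) P s‖) * (1 + ‖x - y‖) ^ M := by
          rw [mul_pow]; ring
        _ ≤ _ := by gcongr; exact h s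
  calc _ ≤ (1 + ‖y‖) ^ M * ((C * (1 + ‖x - y‖) ^ M / (1 + ‖y‖) ^ M) * ‖x - y‖) := by gcongr
    _ = _ := by field_simp

theorem exists_norm_sub_le (P : 𝓢(E, V)) (M : ℕ) :
    ∃ C, 0 ≤ C ∧ ∀ x y, (1 + ‖y‖) ^ M * ‖P x - P y‖ ≤ C * ‖x - y‖ * (1 + ‖x - y‖) ^ M := by
  obtain ⟨C, hC, h⟩ := exists_norm_iteratedFDeriv_sub_le P M 0
  refine ⟨C, hC, fun x y => ?_⟩
  have := h x y
  rwa [iteratedFDeriv_zero_eq_comp, Function.comp_apply, Function.comp_apply, ← map_sub,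
    LinearIsometryEquiv.norm_map] at this

/-- The translate `t ↦ P (t - x)` of a Schwartz function. -/
abbrev translate [NormedSpace ℂ V] (x : E) (P : 𝓢(E, V)) : 𝓢(E, V) :=
  SchwartzMap.compSubConstCLM ℂ x P

theorem iteratedFDeriv_translate [NormedSpace ℂ V] (x : E) (P : 𝓢(E, V)) (n : ℕ) (t : E) :
    iteratedFDeriv ℝ n (translate x P) t = iteratedFDeriv ℝ n P (t - x) :=
  iteratedFDeriv_comp_sub n x t

/-- Each Schwartz seminorm of a difference of translates is governed by the weighted Lipschitz
estimate, after the weight in `t` is moved to `t - y` at the cost of `(1 + ‖y‖) ^ k`. -/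
theorem continuous_translate [NormedSpace ℂ V] [SMulCommClass ℝ ℂ V] (P : 𝓢(E, V)) :
    Continuous fun x => translate x P := by
  rw [continuous_iff_continuousAt]
  intro y
  refine ((schwartz_withSeminorms ℝ E V).tendsto_nhds _ _).2 ?_
  rintro ⟨k, n⟩ ε hε
  obtain ⟨C, hC, h⟩ := exists_norm_iteratedFDeriv_sub_le P k n
  have hb : ∀ x, SchwartzMap.seminorm ℝ k n (translate x P - translate y P) ≤
      (1 + ‖y‖) ^ k * (C * ‖x - y‖ * (1 + ‖x - y‖) ^ k) := by
    intro x
    refine SchwartzMap.seminorm_le_bound ℝ k n _ (by positivity) fun t => ?_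
    have e : iteratedFDeriv ℝ n (translate x P - translate y P) t =
        iteratedFDeriv ℝ n P (t - x) - iteratedFDeriv ℝ n P (t - y) := by
      have h1 := iteratedFDeriv_sub_apply (𝕜 := ℝ) (i := n) (x := t)
        (((translate x P).smooth n).contDiffAt) (((translate y P).smooth n).contDiffAt)
      rw [iteratedFDeriv_translate, iteratedFDeriv_translate] at h1
      exact h1
    rw [e]
    have h1 : ‖t‖ ≤ (1 + ‖y‖) * (1 + ‖t - y‖) := by
      linarith [one_add_norm_le_mul t y]
    have h2 := h (t - x) (t - y)
    have e2 : t - x - (t - y) = -(x - y) := by abel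
    rw [e2, norm_neg] at h2
    calc _ ≤ ((1 + ‖y‖) * (1 + ‖t - y‖)) ^ k *
          ‖iteratedFDeriv ℝ n P (t - x) - iteratedFDeriv ℝ n P (t - y)‖ := by gcongr
      _ = (1 + ‖y‖) ^ k * ((1 + ‖t - y‖) ^ k *
          ‖iteratedFDeriv ℝ n P (t - x) - iteratedFDeriv ℝ n P (t - y)‖) := by
        rw [mul_pow]; ring
      _ ≤ _ := by gcongr
  have hlim : Filter.Tendsto (fun x => (1 + ‖y‖) ^ k * (C * ‖x - y‖ * (1 + ‖x - y‖) ^ k))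
      (nhds y) (nhds 0) := by
    have hc : Continuous fun x => (1 + ‖y‖) ^ k * (C * ‖x - y‖ * (1 + ‖x - y‖) ^ k) := by
      fun_prop
    simpa using hc.tendsto y
  filter_upwards [hlim.eventually (gt_mem_nhds hε)] with x hx
  exact (hb x).trans_lt hx

theorem exists_seminorm_translate_le [NormedSpace ℂ V] (P : 𝓢(E, V)) (k n : ℕ) :
    ∃ C, 0 ≤ C ∧ ∀ x, SchwartzMap.seminorm ℝ k n (translate x P) ≤ C * (1 + ‖x‖) ^ k := by
  obtain ⟨C, hC, h⟩ := exists_one_add_norm_pow_mul_le P k n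
  refine ⟨C, hC, fun x => ?_⟩
  refine SchwartzMap.seminorm_le_bound ℝ k n _ (by positivity) fun t => ?_
  rw [iteratedFDeriv_translate]
  have h1 : ‖t‖ ≤ (1 + ‖x‖) * (1 + ‖t - x‖) := by
    linarith [one_add_norm_le_mul t x]
  calc _ ≤ ((1 + ‖x‖) * (1 + ‖t - x‖)) ^ k * ‖iteratedFDeriv ℝ n P (t - x)‖ := by gcongr
    _ = ((1 + ‖t - x‖) ^ k * ‖iteratedFDeriv ℝ n P (t - x)‖) * (1 + ‖x‖) ^ k := by
      rw [mul_pow]; ring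
    _ ≤ _ := by gcongr; exact h _

end Translation

/-! ### Factoring functionals through Banach spaces -/

section Extension

/-- A linear functional dominated by the norm of a linear map factors through that map. -/
theorem exists_clm_comp_eq {S B : Type*} [AddCommGroup S] [Module ℂ S] [NormedAddCommGroup B]
    [NormedSpace ℂ B] (Φ : S →ₗ[ℂ] B) (f : S →ₗ[ℂ] ℂ) {C : ℝ} (hC : 0 ≤ C)
    (h : ∀ g, ‖f g‖ ≤ C * ‖Φ g‖) : ∃ F : B →L[ℂ] ℂ, ‖F‖ ≤ C ∧ ∀ g, F (Φ g) = f g := by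
  obtain ⟨s, hs⟩ := Φ.rangeRestrict.exists_rightInverse_of_surjective
    (LinearMap.range_rangeRestrict Φ)
  have hs' : ∀ v : LinearMap.range Φ, Φ (s v) = v := fun v =>
    congrArg Subtype.val (LinearMap.congr_fun hs v)
  have hb : ∀ v : LinearMap.range Φ, ‖(f ∘ₗ s) v‖ ≤ C * ‖v‖ := by
    intro v
    have := h (s v)
    rwa [hs'] at this
  obtain ⟨F, hF, hn⟩ := exists_extension_norm_eq (LinearMap.range Φ)
    ((f ∘ₗ s).mkContinuous C hb)
  refine ⟨F, hn ▸ LinearMap.mkContinuous_norm_le _ hC hb, fun g => ?_⟩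
  have h1 := hF ⟨Φ g, LinearMap.mem_range_self Φ g⟩
  rw [LinearMap.mkContinuous_apply, LinearMap.comp_apply] at h1
  -- The domination forces `f` to vanish on the kernel of `Φ`, so the choice of section `s` does not
  -- matter.
  have h2 : f (s ⟨Φ g, LinearMap.mem_range_self Φ g⟩ - g) = 0 := by
    have h3 := h (s ⟨Φ g, LinearMap.mem_range_self Φ g⟩ - g)
    rw [map_sub Φ, hs', sub_self, norm_zero, mul_zero] at h3
    exact norm_le_zero_iff.1 h3
  rw [map_sub, sub_eq_zero] at h2
  exact h1.trans h2

end Extension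

/-! ### Tempered distributions as functionals on finitely many jets -/

section Jet

variable {E : Type*} [NormedAddCommGroup E] [NormedSpace ℝ E]

/-- The bounded continuous function `t ↦ ‖t‖ ^ k • D^n g t`. -/
def jetFun (k n : ℕ) (g : 𝓢(E, ℂ)) : BoundedContinuousFunction E (E [×n]→L[ℝ] ℂ) :=
  BoundedContinuousFunction.ofNormedAddCommGroup (fun t => (‖t‖ ^ k) • iteratedFDeriv ℝ n g t)
    ((continuous_norm.pow k).smul ((g.smooth n).continuous_iteratedFDeriv le_rfl))
    (SchwartzMap.seminorm ℝ k n g) fun t => by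
      rw [norm_smul, norm_pow, norm_norm]
      exact SchwartzMap.le_seminorm ℝ k n g t

theorem jetFun_apply (k n : ℕ) (g : 𝓢(E, ℂ)) (t : E) :
    jetFun k n g t = (‖t‖ ^ k) • iteratedFDeriv ℝ n g t := rfl

theorem norm_jetFun (k n : ℕ) (g : 𝓢(E, ℂ)) :
    ‖jetFun k n g‖ = SchwartzMap.seminorm ℝ k n g := by
  apply le_antisymm
  · exact BoundedContinuousFunction.norm_ofNormedAddCommGroup_le _ (apply_nonneg _ _) _
  · refine SchwartzMap.seminorm_le_bound ℝ k n _ (norm_nonneg (jetFun k n g)) fun t => ?_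
    have := (jetFun k n g).norm_coe_le_norm t
    rwa [jetFun_apply, norm_smul, norm_pow, norm_norm] at this

/-- The Banach space of bounded continuous `n`-linear-map valued functions. -/
def JetSpace (E : Type*) [NormedAddCommGroup E] [NormedSpace ℝ E] (n : ℕ) : Type _ :=
  BoundedContinuousFunction E (E [×n]→L[ℝ] ℂ)

instance (n : ℕ) : NormedAddCommGroup (JetSpace E n) :=
  inferInstanceAs (NormedAddCommGroup (BoundedContinuousFunction E (E [×n]→L[ℝ] ℂ)))

instance (n : ℕ) : NormedSpace ℂ (JetSpace E n) :=
  inferInstanceAs (NormedSpace ℂ (BoundedContinuousFunction E (E [×n]→L[ℝ] ℂ)))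

instance (n : ℕ) : CompleteSpace (JetSpace E n) :=
  inferInstanceAs (CompleteSpace (BoundedContinuousFunction E (E [×n]→L[ℝ] ℂ)))

/-- Evaluation of the multilinear map at a point on given vectors. -/
def JetSpace.eval {n : ℕ} (t : E) (m : Fin n → E) : JetSpace E n →L[ℂ] ℂ :=
  LinearMap.mkContinuous
    { toFun := fun F => (show BoundedContinuousFunction E (E [×n]→L[ℝ] ℂ) from F) t m
      map_add' := fun _ _ => rfl
      map_smul' := fun _ _ => rfl } (∏ i, ‖m i‖) fun F => by
      refine (ContinuousMultilinearMap.le_opNorm _ m).trans ?_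
      rw [mul_comm]
      gcongr
      exact BoundedContinuousFunction.norm_coe_le_norm
        (show BoundedContinuousFunction E (E [×n]→L[ℝ] ℂ) from F) t

theorem JetSpace.ext_eval {n : ℕ} {F G : JetSpace E n} (h : ∀ t m, eval t m F = eval t m G) :
    F = G :=
  BoundedContinuousFunction.ext fun t => ContinuousMultilinearMap.ext fun m => h t m

/-- `jetFun` as a continuous linear map. -/
def jet (k n : ℕ) : 𝓢(E, ℂ) →L[ℂ] JetSpace E n :=
  SchwartzMap.mkCLMtoNormedSpace (fun g : 𝓢(E, ℂ) => (jetFun k n g : JetSpace E n))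
    (fun f g => BoundedContinuousFunction.ext fun t => by
      have := iteratedFDeriv_add_apply (𝕜 := ℝ) (i := n) (x := t)
        ((f.smooth n).contDiffAt) ((g.smooth n).contDiffAt)
      change (‖t‖ ^ k) • iteratedFDeriv ℝ n (f + g : E → ℂ) t =
        (‖t‖ ^ k) • iteratedFDeriv ℝ n f t + (‖t‖ ^ k) • iteratedFDeriv ℝ n g t
      rw [this, smul_add])
    (fun a f => BoundedContinuousFunction.ext fun t => by
      have := iteratedFDeriv_const_smul_apply (𝕜 := ℝ) (i := n) (x := t) (a := a)
        ((f.smooth n).contDiffAt)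
      change (‖t‖ ^ k) • iteratedFDeriv ℝ n (a • f : E → ℂ) t =
        a • (‖t‖ ^ k) • iteratedFDeriv ℝ n f t
      rw [this, smul_comm])
    ⟨{(k, n)}, 1, zero_le_one, fun f => by
      rw [Finset.sup_singleton, one_mul]
      exact (norm_jetFun k n f).le⟩

theorem norm_jet (k n : ℕ) (g : 𝓢(E, ℂ)) : ‖jet k n g‖ = SchwartzMap.seminorm ℝ k n g :=
  norm_jetFun k n g

/-- Finitely many jets. -/
def jets (s : Finset (ℕ × ℕ)) : 𝓢(E, ℂ) →L[ℂ] ((i : s) → JetSpace E i.1.2) :=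
  ContinuousLinearMap.pi fun i => jet i.1.1 i.1.2

/-- Tempered distributions factor through finitely many jets. -/
theorem exists_jets_factor (f : 𝓢'(E, ℂ)) : ∃ (s : Finset (ℕ × ℕ))
    (F : ((i : s) → JetSpace E i.1.2) →L[ℂ] ℂ),
    ∀ g, f g = F (jets s g) := by
  let q : Seminorm ℂ 𝓢(E, ℂ) := (normSeminorm ℂ ℂ).comp f.toLinearMap
  have hq : Continuous q := by
    change Continuous fun g => ‖f g‖
    exact (map_continuous f).norm
  obtain ⟨s, C, -, h⟩ := Seminorm.bound_of_continuous (schwartz_withSeminorms ℂ E ℂ) q hq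
  have hb : ∀ g, ‖f.toLinearMap g‖ ≤ C * ‖(jets s).toLinearMap g‖ := by
    intro g
    have h1 : ‖f g‖ ≤ C * (s.sup (schwartzSeminormFamily ℂ E ℂ)) g := h g
    refine h1.trans ?_
    gcongr
    refine Seminorm.finset_sup_apply_le (norm_nonneg _) fun i hi => ?_
    exact (norm_jet i.1 i.2 g).ge.trans (norm_le_pi_norm (jets s g) ⟨i, hi⟩)
  obtain ⟨F, -, hF⟩ := exists_clm_comp_eq (jets s).toLinearMap f.toLinearMap (by positivity) hb
  exact ⟨s, F, fun g => (hF g).symm⟩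

theorem exists_norm_jets_translate_le (s : Finset (ℕ × ℕ)) (P : 𝓢(E, ℂ)) :
    ∃ (C : ℝ) (N : ℕ), 0 ≤ C ∧ ∀ x, ‖jets s (translate x P)‖ ≤ C * (1 + ‖x‖) ^ N := by
  choose C hC h using fun i : ℕ × ℕ => exists_seminorm_translate_le P i.1 i.2
  refine ⟨∑ i ∈ s, C i, s.sup Prod.fst, Finset.sum_nonneg fun i _ => hC i, fun x => ?_⟩
  have hpos : 0 ≤ ∑ i ∈ s, C i := Finset.sum_nonneg fun i _ => hC i
  refine (pi_norm_le_iff_of_nonneg (by positivity)).2 fun i => ?_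
  change ‖jet i.1.1 i.1.2 (translate x P)‖ ≤ _
  rw [norm_jet]
  refine (h i.1 x).trans ?_
  have h1 : C i.1 ≤ ∑ i ∈ s, C i :=
    Finset.single_le_sum (f := C) (fun i _ => hC i) i.2
  have h2 : i.1.1 ≤ s.sup Prod.fst := Finset.le_sup (f := Prod.fst) i.2
  have h3 : 1 ≤ 1 + ‖x‖ := by linarith [norm_nonneg x]
  gcongr

/-- Polynomial growth of `x ↦ ⟨f, P(· - x)⟩`. -/
theorem exists_norm_apply_translate_le (f : 𝓢'(E, ℂ)) (P : 𝓢(E, ℂ)) :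
    ∃ (C : ℝ) (N : ℕ), 0 ≤ C ∧ ∀ x, ‖f (translate x P)‖ ≤ C * (1 + ‖x‖) ^ N := by
  obtain ⟨s, F, hF⟩ := exists_jets_factor f
  obtain ⟨C, N, hC, h⟩ := exists_norm_jets_translate_le s P
  refine ⟨‖F‖ * C, N, by positivity, fun x => ?_⟩
  rw [hF, mul_assoc]
  exact (F.le_opNorm _).trans (by gcongr; exact h x)

theorem continuous_apply_translate (f : 𝓢'(E, ℂ)) (P : 𝓢(E, ℂ)) :
    Continuous fun x => f (translate x P) :=
  (map_continuous f).comp (continuous_translate P)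

end Jet

/-! ### Convolution and tempered distributions -/

section Convolution

variable {E : Type*} [NormedAddCommGroup E] [InnerProductSpace ℝ E] [FiniteDimensional ℝ E]
  [MeasurableSpace E] [BorelSpace E]

/-- Convolution of scalar Schwartz functions. -/
abbrev conv (h P : 𝓢(E, ℂ)) : 𝓢(E, ℂ) :=
  SchwartzMap.convolution (ContinuousLinearMap.mul ℂ ℂ) h P

theorem conv_apply (h P : 𝓢(E, ℂ)) (t : E) : conv h P t = ∫ x, h x * P (t - x) :=
  SchwartzMap.convolution_apply _ _ _ _

theorem fourier_conv_apply (h P : 𝓢(E, ℂ)) (η : E) : 𝓕 (conv h P) η = 𝓕 h η * 𝓕 P η := by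
  rw [SchwartzMap.fourier_convolution]
  rfl

theorem schwartz_fourier_injective {f g : 𝓢(E, ℂ)} (h : 𝓕 f = 𝓕 g) : f = g := by
  rw [← FourierTransform.fourierInv_fourier_eq (F := 𝓢(E, ℂ)) f, h,
    FourierTransform.fourierInv_fourier_eq (F := 𝓢(E, ℂ)) g]

open LineDeriv in
-- Both operations are multiplications on the Fourier side. This puts every derivative on `P`, so
-- that jets of a convolution are integrals of jets of translates.
theorem lineDerivOp_conv (v : E) (h P : 𝓢(E, ℂ)) : ∂_{v} (conv h P) = conv h (∂_{v} P) := by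
  apply schwartz_fourier_injective
  ext η
  have hg : (fun x : E => inner ℝ x v).HasTemperateGrowth := by fun_prop
  rw [fourier_conv_apply, SchwartzMap.fourier_lineDerivOp_eq, SchwartzMap.fourier_lineDerivOp_eq,
    smul_apply, smul_apply, SchwartzMap.smulLeftCLM_apply_apply hg,
    SchwartzMap.smulLeftCLM_apply_apply hg, fourier_conv_apply]
  simp only [smul_eq_mul, real_smul]
  ring

open LineDeriv in
theorem iteratedLineDerivOp_conv {n : ℕ} (m : Fin n → E) (h P : 𝓢(E, ℂ)) :
    ∂^{m} (conv h P) = conv h (∂^{m} P) := by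
  induction n with
  | zero => rfl
  | succ n ih => rw [iteratedLineDerivOp_succ_left, ih, lineDerivOp_conv]; rfl

theorem integrable_one_add_norm_pow_mul (h : 𝓢(E, ℂ)) (N : ℕ) :
    Integrable fun x => (1 + ‖x‖) ^ N * ‖h x‖ := by
  have h1 : ∀ x : E, (1 + ‖x‖) ^ N * ‖h x‖ =
      ∑ i ∈ Finset.range (N + 1), (N.choose i : ℝ) * (‖x‖ ^ (N - i) * ‖h x‖) := by
    intro x
    rw [add_pow, Finset.sum_mul]
    exact Finset.sum_congr rfl fun i _ => by rw [one_pow]; ring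
  simp_rw [h1]
  exact integrable_finsetSum _ fun i _ => (h.integrable_pow_mul volume _).const_mul _

/-- A tempered distribution applied to a convolution. -/
theorem apply_conv (f : 𝓢'(E, ℂ)) (h P : 𝓢(E, ℂ)) :
    f (conv h P) = ∫ x, h x * f (translate x P) := by
  obtain ⟨s, F, hF⟩ := exists_jets_factor f
  obtain ⟨C, N, hC, hb⟩ := exists_norm_jets_translate_le s P
  have hint : Integrable fun x => h x • jets s (translate x P) := by
    refine Integrable.mono' ((integrable_one_add_norm_pow_mul h N).const_mul C)
      (h.continuous.smul ((jets s).continuous.comp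
        (continuous_translate P))).aestronglyMeasurable (Filter.Eventually.of_forall fun x => ?_)
    rw [norm_smul]
    calc _ ≤ ‖h x‖ * (C * (1 + ‖x‖) ^ N) := by gcongr; exact hb x
      _ = _ := by ring
  -- The convolution is a Bochner integral of translates in a Banach space of jets, where `F` may be
  -- interchanged with the integral. Point evaluations separate jets, so the identity is checked
  -- derivative by derivative.
  have hI : jets s (conv h P) = ∫ x, h x • jets s (translate x P) := by
    refine funext fun i => JetSpace.ext_eval fun t m => ?_
    let ev : ((i : s) → JetSpace E i.1.2) →L[ℂ] ℂ :=
      (JetSpace.eval t m).comp (ContinuousLinearMap.proj i)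
    change ev (jets s (conv h P)) = ev (∫ x, h x • jets s (translate x P))
    rw [← ev.integral_comp_comm hint]
    have h2 : ∀ x, ev (h x • jets s (translate x P)) =
        ((‖t‖ ^ i.1.1 : ℝ) : ℂ) * (h x * LineDeriv.iteratedLineDerivOp m P (t - x)) := by
      intro x
      rw [map_smul]
      change h x • (((‖t‖ ^ i.1.1 : ℝ) : ℂ) * iteratedFDeriv ℝ i.1.2 (translate x P) t m) = _
      rw [iteratedFDeriv_translate, SchwartzMap.iteratedLineDerivOp_eq_iteratedFDeriv,
        smul_eq_mul]
      ring
    simp_rw [h2]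
    rw [integral_const_mul, ← conv_apply, ← iteratedLineDerivOp_conv,
      SchwartzMap.iteratedLineDerivOp_eq_iteratedFDeriv]
    rfl
  rw [hF, hI, ← F.integral_comp_comm hint]
  congr 1 with x
  rw [map_smul, smul_eq_mul, hF]

end Convolution

/-! ### Fourier transforms of dilates, modulations, reflections and products -/

section FourierRules

variable {E : Type*} [NormedAddCommGroup E] [InnerProductSpace ℝ E] [FiniteDimensional ℝ E]
  [MeasurableSpace E] [BorelSpace E]

theorem fourier_comp_smul (φ : E → ℂ) {a : ℝ} (ha : 0 < a) (η : E) :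
    𝓕 (fun t => φ (a • t)) η = ((a ^ Module.finrank ℝ E)⁻¹ : ℝ) * 𝓕 φ (a⁻¹ • η) := by
  rw [Real.fourier_eq', Real.fourier_eq']
  have h := Measure.integral_comp_smul (volume : Measure E)
    (fun v => cexp (↑(-2 * Real.pi * inner ℝ v (a⁻¹ • η)) * I) • φ v) a
  rw [abs_of_pos (by positivity), real_smul] at h
  rw [← h]
  congr 1 with v
  rw [inner_smul_left, inner_smul_right]
  simp only [conj_trivial]
  rw [mul_inv_cancel_left₀ ha.ne']

/-- The packets use `exp (i t·ξ)`, whereas `𝓕` carries a `2π` in the exponent. Hence a packet at `ξ`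
sits at the frequency `ξ / 2π` throughout. -/
theorem fourier_character_mul (φ : E → ℂ) (ξ η : E) :
    𝓕 (fun t => cexp (((inner ℝ t ξ : ℝ) : ℂ) * I) * φ t) η =
      𝓕 φ (η - (2 * Real.pi)⁻¹ • ξ) := by
  rw [Real.fourier_eq', Real.fourier_eq']
  congr 1 with v
  rw [smul_eq_mul, smul_eq_mul, ← mul_assoc, ← Complex.exp_add, ← add_mul, ← ofReal_add]
  congr 4
  rw [inner_sub_right, inner_smul_right]
  field_simp
  ring

theorem fourier_conj (φ : E → ℂ) (η : E) :
    𝓕 (fun t => conj (φ t)) η = conj (𝓕 φ (-η)) := by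
  rw [Real.fourier_eq', Real.fourier_eq', ← integral_conj]
  congr 1 with v
  rw [smul_eq_mul, smul_eq_mul, map_mul, ← exp_conj, map_mul, conj_I, conj_ofReal, inner_neg_right]
  push_cast
  ring_nf

theorem fourier_comp_sub_left (φ : E → ℂ) (t η : E) :
    𝓕 (fun z => φ (t - z)) η =
      cexp (↑(-2 * Real.pi * inner ℝ t η) * I) * 𝓕 φ (-η) := by
  rw [Real.fourier_eq', Real.fourier_eq']
  rw [← integral_sub_left_eq_self _ volume t, ← integral_const_mul]
  congr 1 with v
  rw [sub_sub_cancel, inner_sub_left, inner_neg_right, smul_eq_mul, smul_eq_mul, ← mul_assoc,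
    ← Complex.exp_add, ← add_mul, ← ofReal_add]
  congr 4
  ring

/-- Pointwise product of scalar Schwartz functions. -/
abbrev mulS (p q : 𝓢(E, ℂ)) : 𝓢(E, ℂ) := SchwartzMap.pairing (ContinuousLinearMap.mul ℂ ℂ) p q

theorem mulS_apply (p q : 𝓢(E, ℂ)) (t : E) : mulS p q t = p t * q t := rfl

/-- Applying `𝓕` once more reduces this to the convolution theorem, because `𝓕 ∘ 𝓕` is the
reflection `x ↦ -x`, which respects products. -/
theorem fourier_eq_conv (p q : 𝓢(E, ℂ)) : 𝓕 (mulS p q) = conv (𝓕 p) (𝓕 q) := by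
  have h : ∀ g : 𝓢(E, ℂ), 𝓕⁻ (𝓕 g) = g := fun g =>
    FourierTransform.fourierInv_fourier_eq (F := 𝓢(E, ℂ)) g
  have h' : ∀ g : 𝓢(E, ℂ), 𝓕 (𝓕⁻ g) = g := fun g =>
    FourierTransform.fourier_fourierInv_eq (E := 𝓢(E, ℂ)) g
  have hneg : ∀ (g : 𝓢(E, ℂ)) (η : E), (𝓕⁻ g) η = (𝓕 g) (-η) := fun g η => by
    rw [SchwartzMap.fourierInv_coe, SchwartzMap.fourier_coe, Real.fourierInv_eq_fourier_neg]
  have key : ∀ g : 𝓢(E, ℂ), 𝓕 (𝓕 g) = SchwartzMap.compCLMOfContinuousLinearEquiv ℂ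
      (ContinuousLinearEquiv.neg ℝ (M := E)) g := by
    intro g
    ext x
    have := hneg (𝓕 g) (-x)
    rw [h, neg_neg] at this
    rw [← this]
    rfl
  apply schwartz_fourier_injective
  rw [key]
  ext x
  rw [fourier_conv_apply, key, key]
  rfl

theorem fourier_mulS_apply (p q : 𝓢(E, ℂ)) (η : E) :
    𝓕 (mulS p q) η = ∫ ζ, 𝓕 p ζ * 𝓕 q (η - ζ) := by
  rw [fourier_eq_conv, conv_apply]

/-- The frequency support of a product lies in the sum of the frequency supports. -/
theorem fourier_mulS_eq_zero {p q : 𝓢(E, ℂ)} {u v : E} {r s : ℝ}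
    (hp : ∀ ζ, 𝓕 p ζ ≠ 0 → ‖ζ - u‖ ≤ r) (hq : ∀ ζ, 𝓕 q ζ ≠ 0 → ‖ζ - v‖ ≤ s) {η : E}
    (hη : r + s < ‖η - (u + v)‖) : 𝓕 (mulS p q) η = 0 := by
  rw [fourier_mulS_apply]
  refine integral_eq_zero_of_ae (Filter.Eventually.of_forall fun ζ => ?_)
  by_contra hne
  rw [Pi.zero_apply] at hne
  have h1 := hp ζ (left_ne_zero_of_mul hne)
  have h2 := hq (η - ζ) (right_ne_zero_of_mul hne)
  have h3 : η - (u + v) = (ζ - u) + (η - ζ - v) := by abel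
  have := norm_add_le (ζ - u) (η - ζ - v)
  rw [h3] at hη
  linarith

/-- The dilate `t ↦ φ (a t)`. -/
def dilate (a : ℝ) (ha : 0 < a) (φ : 𝓢(E, ℂ)) : 𝓢(E, ℂ) :=
  SchwartzMap.compCLMOfContinuousLinearEquiv ℂ
    (ContinuousLinearEquiv.smulLeft (R₁ := ℝ) (M₁ := E) (Units.mk0 a ha.ne')) φ

theorem dilate_apply (a : ℝ) (ha : 0 < a) (φ : 𝓢(E, ℂ)) (t : E) : dilate a ha φ t = φ (a • t) :=
  rfl

theorem fourier_dilate (a : ℝ) (ha : 0 < a) (φ : 𝓢(E, ℂ)) (η : E) :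
    𝓕 (dilate a ha φ) η = ((a ^ Module.finrank ℝ E)⁻¹ : ℝ) * 𝓕 φ (a⁻¹ • η) := by
  rw [SchwartzMap.fourier_coe, SchwartzMap.fourier_coe, ← fourier_comp_smul _ ha]
  rfl

theorem hasTemperateGrowth_cexp_inner (ξ : E) :
    (fun t : E => cexp (((inner ℝ t ξ : ℝ) : ℂ) * I)).HasTemperateGrowth :=
  hasTemperateGrowth_cexp_ofReal_mul_I.comp ((innerSL ℝ).flip ξ).hasTemperateGrowth

/-- The modulation `t ↦ exp (i t·ξ) φ t`. -/
def modulate (ξ : E) (φ : 𝓢(E, ℂ)) : 𝓢(E, ℂ) :=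
  SchwartzMap.smulLeftCLM ℂ (fun t : E => cexp (((inner ℝ t ξ : ℝ) : ℂ) * I)) φ

theorem modulate_apply (ξ : E) (φ : 𝓢(E, ℂ)) (t : E) :
    modulate ξ φ t = cexp (((inner ℝ t ξ : ℝ) : ℂ) * I) * φ t :=
  SchwartzMap.smulLeftCLM_apply_apply (hasTemperateGrowth_cexp_inner ξ) φ t

theorem fourier_modulate (ξ : E) (φ : 𝓢(E, ℂ)) (η : E) :
    𝓕 (modulate ξ φ) η = 𝓕 φ (η - (2 * Real.pi)⁻¹ • ξ) := by
  rw [SchwartzMap.fourier_coe, SchwartzMap.fourier_coe, ← fourier_character_mul]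
  exact congrFun (congrArg _ (funext (modulate_apply ξ φ))) η

/-- The reflected translate `z ↦ φ (t - z)`. -/
def reflect (t : E) (φ : 𝓢(E, ℂ)) : 𝓢(E, ℂ) :=
  translate t (SchwartzMap.compCLMOfContinuousLinearEquiv ℂ (ContinuousLinearEquiv.neg ℝ (M := E)) φ)

theorem reflect_apply (t : E) (φ : 𝓢(E, ℂ)) (z : E) : reflect t φ z = φ (t - z) := by
  change φ (-(z - t)) = φ (t - z)
  rw [neg_sub]

theorem fourier_reflect (t : E) (φ : 𝓢(E, ℂ)) (η : E) :
    𝓕 (reflect t φ) η = cexp (↑(-2 * Real.pi * inner ℝ t η) * I) * 𝓕 φ (-η) := by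
  rw [SchwartzMap.fourier_coe, SchwartzMap.fourier_coe, ← fourier_comp_sub_left]
  exact congrFun (congrArg _ (funext (reflect_apply t φ))) η

theorem norm_fourier_reflect (t : E) (φ : 𝓢(E, ℂ)) (η : E) :
    ‖𝓕 (reflect t φ) η‖ = ‖𝓕 φ (-η)‖ := by
  rw [fourier_reflect, norm_mul, norm_exp_ofReal_mul_I, one_mul]

/-- Plancherel's theorem in terms of lower integrals. -/
theorem lintegral_fourier_sq (g : 𝓢(E, ℂ)) : ∫⁻ η, ‖𝓕 g η‖ₑ ^ 2 = ∫⁻ x, ‖g x‖ₑ ^ 2 := by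
  have hint : ∀ f : 𝓢(E, ℂ), ∫⁻ x, ‖f x‖ₑ ^ 2 = ENNReal.ofReal (∫ x, ‖f x‖ ^ 2) := by
    intro f
    rw [ofReal_integral_eq_lintegral_ofReal]
    · congr 1 with x
      rw [ENNReal.ofReal_pow (norm_nonneg _), ofReal_norm]
    · have := (f.memLp 2 volume).integrable_norm_pow (by norm_num)
      simpa using this
    · exact Filter.Eventually.of_forall fun x => by positivity
  rw [hint, hint, SchwartzMap.integral_norm_sq_fourier]

end FourierRules

/-! ### Band-limited kernels and cutoffs -/

section Kernels

variable {E : Type*} [NormedAddCommGroup E] [InnerProductSpace ℝ E] [FiniteDimensional ℝ E]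
  [MeasurableSpace E] [BorelSpace E]

/-- A bump function as a complex Schwartz function. -/
def bumpS {c : E} (b : ContDiffBump c) : 𝓢(E, ℂ) :=
  HasCompactSupport.toSchwartzMap (f := fun x => ((b x : ℝ) : ℂ))
    (b.hasCompactSupport.comp_left (g := fun r : ℝ => (r : ℂ)) ofReal_zero)
    (ofRealCLM.contDiff.comp b.contDiff)

theorem bumpS_apply {c : E} (b : ContDiffBump c) (x : E) : bumpS b x = ((b x : ℝ) : ℂ) := rfl

/-- A Schwartz kernel whose Fourier transform is a cutoff equal to `1` on a prescribed ball. -/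
theorem exists_kernel (R : ℝ) (hR : 0 < R) : ∃ K : 𝓢(E, ℂ),
    (∀ η, ‖η‖ ≤ R → 𝓕 K η = 1) ∧ (∀ η, ‖𝓕 K η‖ ≤ 1) ∧ HasCompactSupport (𝓕 K : 𝓢(E, ℂ)) := by
  let b : ContDiffBump (0 : E) := ⟨R, R + 1, hR, by linarith⟩
  have h : 𝓕 (𝓕⁻ (bumpS b)) = bumpS b :=
    FourierTransform.fourier_fourierInv_eq (E := 𝓢(E, ℂ)) _
  refine ⟨𝓕⁻ (bumpS b), fun η hη => ?_, fun η => ?_, ?_⟩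
  · rw [h, bumpS_apply, b.one_of_mem_closedBall (by simpa using hη), ofReal_one]
  · rw [h, bumpS_apply, norm_real, Real.norm_of_nonneg b.nonneg]
    exact b.le_one
  · rw [h]
    exact b.hasCompactSupport.comp_left (g := fun r : ℝ => (r : ℂ)) ofReal_zero

/-- The inverse transform of a nonnegative bump, divided by the integral of the bump: nonnegativity
makes its modulus maximal at the origin. -/
theorem exists_cutoff : ∃ ψ : 𝓢(E, ℂ), ψ 0 = 1 ∧ (∀ x, ‖ψ x‖ ≤ 1) ∧
    ∀ η, 𝓕 ψ η ≠ 0 → ‖η‖ ≤ 1 := by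
  let b : ContDiffBump (0 : E) := ⟨1 / 2, 1, by norm_num, by norm_num⟩
  have hpos : 0 < ∫ x, b x := b.integral_pos
  have h : 𝓕 (𝓕⁻ (bumpS b)) = bumpS b :=
    FourierTransform.fourier_fourierInv_eq (E := 𝓢(E, ℂ)) _
  have hval : ∀ x, (𝓕⁻ (bumpS b)) x =
      ∫ v, cexp (↑(2 * Real.pi * inner ℝ v x) * I) • ((b v : ℝ) : ℂ) := by
    intro x
    rw [SchwartzMap.fourierInv_coe, Real.fourierInv_eq']
    rfl
  refine ⟨(((∫ x, b x : ℝ) : ℂ)⁻¹) • 𝓕⁻ (bumpS b), ?_, fun x => ?_, fun η hη => ?_⟩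
  · rw [smul_apply, hval]
    simp only [inner_zero_right, mul_zero, ofReal_zero, zero_mul, Complex.exp_zero, one_smul]
    rw [integral_complex_ofReal, smul_eq_mul, inv_mul_cancel₀]
    exact_mod_cast hpos.ne'
  · rw [smul_apply, hval, norm_smul, norm_inv, norm_real, Real.norm_of_nonneg hpos.le,
      inv_mul_le_iff₀ hpos, mul_one]
    refine (norm_integral_le_integral_norm _).trans (le_of_eq ?_)
    congr 1 with v
    rw [norm_smul, norm_exp_ofReal_mul_I, one_mul, norm_real, Real.norm_of_nonneg b.nonneg]
  · rw [FourierTransform.fourier_smul, h, smul_apply, bumpS_apply] at hη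
    by_contra hc
    apply hη
    rw [b.zero_of_le_dist (by simpa using (not_le.1 hc).le), ofReal_zero, smul_zero]

/-- Modulated cutoffs concentrated near the frequency `ω`, with moduli tending to `1`. -/
theorem exists_modulated_cutoffs (ω : E) {a : ℝ} (ha : 0 < a) : ∃ q : ℕ → 𝓢(E, ℂ),
    (∀ n η, 𝓕 (q n) η ≠ 0 → ‖η - ω‖ ≤ a) ∧ (∀ n x, ‖q n x‖ ≤ 1) ∧
    ∀ x, Filter.Tendsto (fun n => ‖q n x‖) Filter.atTop (nhds 1) := by
  obtain ⟨ψ, h0, h1, hs⟩ := exists_cutoff (E := E)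
  have hpos : ∀ n : ℕ, 0 < a / ((n : ℝ) + 1) := fun n => by positivity
  have hn : ∀ n x, ‖modulate ((2 * Real.pi) • ω) (dilate _ (hpos n) ψ) x‖ =
      ‖ψ ((a / ((n : ℝ) + 1)) • x)‖ := by
    intro n x
    rw [modulate_apply, norm_mul, norm_exp_ofReal_mul_I, one_mul, dilate_apply]
  refine ⟨fun n => modulate ((2 * Real.pi) • ω) (dilate _ (hpos n) ψ), fun n η hη => ?_,
    fun n x => (hn n x).le.trans (h1 _), fun x => ?_⟩
  · rw [fourier_modulate, fourier_dilate, smul_smul, inv_mul_cancel₀ (by positivity),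
      one_smul] at hη
    have h2 := hs _ (right_ne_zero_of_mul hη)
    rw [norm_smul, norm_inv, Real.norm_of_nonneg (hpos n).le, inv_mul_le_iff₀ (hpos n),
      mul_one] at h2
    refine h2.trans (div_le_self ha.le ?_)
    linarith [(Nat.cast_nonneg n : (0 : ℝ) ≤ n)]
  · simp_rw [hn]
    have hlim : Filter.Tendsto (fun n : ℕ => (a / ((n : ℝ) + 1)) • x) Filter.atTop (nhds 0) := by
      have h3 : Filter.Tendsto (fun n : ℕ => a / ((n : ℝ) + 1)) Filter.atTop (nhds 0) := by
        have := tendsto_one_div_add_atTop_nhds_zero_nat (𝕜 := ℝ)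
        simpa [div_eq_mul_inv] using this.const_mul a
      simpa using h3.smul_const x
    have h4 := ((ψ.continuous.norm).tendsto 0).comp hlim
    rw [h0, norm_one] at h4
    exact h4

end Kernels

/-! ### Sampling of band-limited transforms of tempered distributions -/

section Bandlimited

variable {E : Type*} [NormedAddCommGroup E] [InnerProductSpace ℝ E] [FiniteDimensional ℝ E]
  [MeasurableSpace E] [BorelSpace E]

theorem integrable_mul_apply_translate (f : 𝓢'(E, ℂ)) (h P : 𝓢(E, ℂ)) :
    Integrable fun x => h x * f (translate x P) := by
  obtain ⟨C, N, hC, hb⟩ := exists_norm_apply_translate_le f P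
  refine Integrable.mono' ((integrable_one_add_norm_pow_mul h N).const_mul C)
    (h.continuous.mul (continuous_apply_translate f P)).aestronglyMeasurable
    (Filter.Eventually.of_forall fun x => ?_)
  rw [norm_mul]
  calc _ ≤ ‖h x‖ * (C * (1 + ‖x‖) ^ N) := by gcongr; exact hb x
    _ = _ := by ring

/-- Schwartz decay beats polynomial growth. This is the a priori finiteness without which the
oscillation term could not be absorbed. -/
theorem lintegral_mul_apply_translate_sq_lt_top (f : 𝓢'(E, ℂ)) (h P : 𝓢(E, ℂ)) :
    ∫⁻ x, ‖h x * f (translate x P)‖ₑ ^ 2 < ∞ := by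
  obtain ⟨C, N, hC, hb⟩ := exists_norm_apply_translate_le f P
  obtain ⟨D, hD, hd⟩ := exists_one_add_norm_pow_mul_le h N 0
  have hd' : ∀ x, (1 + ‖x‖) ^ N * ‖h x‖ ≤ D := fun x => by
    have := hd x
    rwa [norm_iteratedFDeriv_zero] at this
  have hi := (integrable_mul_apply_translate f h P).2
  calc ∫⁻ x, ‖h x * f (translate x P)‖ₑ ^ 2
      ≤ ∫⁻ x, ENNReal.ofReal (C * D) * ‖h x * f (translate x P)‖ₑ := by
        refine lintegral_mono fun x => ?_
        rw [sq]
        gcongr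
        rw [← ofReal_norm]
        apply ENNReal.ofReal_le_ofReal
        rw [norm_mul]
        calc _ ≤ ‖h x‖ * (C * (1 + ‖x‖) ^ N) := by gcongr; exact hb x
          _ = C * ((1 + ‖x‖) ^ N * ‖h x‖) := by ring
          _ ≤ _ := by gcongr; exact hd' x
    _ = ENNReal.ofReal (C * D) * ∫⁻ x, ‖h x * f (translate x P)‖ₑ :=
        lintegral_const_mul' _ _ ENNReal.ofReal_ne_top
    _ < ∞ := ENNReal.mul_lt_top ENNReal.ofReal_lt_top hi

/-- The `L¹`-normalized dilate of a kernel. -/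
def dilateL1 (a : ℝ) (ha : 0 < a) (K : 𝓢(E, ℂ)) : 𝓢(E, ℂ) :=
  ((a ^ Module.finrank ℝ E : ℝ) : ℂ) • dilate a ha K

theorem dilateL1_apply (a : ℝ) (ha : 0 < a) (K : 𝓢(E, ℂ)) (x : E) :
    dilateL1 a ha K x = ((a ^ Module.finrank ℝ E : ℝ) : ℂ) * K (a • x) := rfl

theorem fourier_dilateL1 (a : ℝ) (ha : 0 < a) (K : 𝓢(E, ℂ)) (η : E) :
    𝓕 (dilateL1 a ha K) η = 𝓕 K (a⁻¹ • η) := by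
  rw [dilateL1, FourierTransform.fourier_smul, smul_apply, fourier_dilate, smul_eq_mul,
    ← mul_assoc, ← ofReal_mul, mul_inv_cancel₀ (by positivity), ofReal_one, one_mul]

/-- Reproducing formula for the cut-off transform `x ↦ q x ⟨f, P(· - x)⟩` of a tempered
distribution, for a band-limited window `P`. -/
theorem mul_apply_translate_eq_integral {K : 𝓢(E, ℂ)} {R a : ℝ} (ha : 0 < a)
    (hK : ∀ η, ‖η‖ ≤ R + 1 → 𝓕 K η = 1) {P q : 𝓢(E, ℂ)} {ω : E}
    (hP : ∀ η, 𝓕 P η ≠ 0 → ‖η - ω‖ ≤ a * R) (hq : ∀ η, 𝓕 q η ≠ 0 → ‖η - ω‖ ≤ a)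
    (f : 𝓢'(E, ℂ)) (x : E) :
    q x * f (translate x P) =
      ∫ z, mulS (reflect x (dilateL1 a ha K)) q z * f (translate z P) := by
  rw [← apply_conv]
  have hconv : conv (mulS (reflect x (dilateL1 a ha K)) q) P = q x • translate x P := by
    ext t
    -- Reflection moves the frequency centre of `P` from `ω` to `-ω`, cancelling that of `q`. The
    -- product therefore lives in the ball of radius `a (R + 1)` about `0`, on which the dilated
    -- kernel has Fourier transform `1`.
    have hrep : conv (mulS q (reflect t P)) (dilateL1 a ha K) = mulS q (reflect t P) := by
      apply schwartz_fourier_injective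
      ext η
      rw [fourier_conv_apply, fourier_dilateL1]
      by_cases hη : ‖η‖ ≤ a * (R + 1)
      · rw [hK, mul_one]
        rwa [norm_smul, norm_inv, Real.norm_of_nonneg ha.le, inv_mul_le_iff₀ ha]
      · rw [fourier_mulS_eq_zero (r := a) (s := a * R) (u := ω) (v := -ω) hq, zero_mul]
        · intro ζ hζ
          have h1 : 𝓕 P (-ζ) ≠ 0 := by
            rw [← norm_ne_zero_iff, norm_fourier_reflect] at hζ
            exact norm_ne_zero_iff.1 hζ
          have h2 := hP _ h1
          rwa [← norm_neg, show -(ζ - -ω) = -ζ - ω by abel]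
        · rw [add_neg_cancel, sub_zero]
          linarith [not_le.1 hη]
    have h1 := congrArg (fun g : 𝓢(E, ℂ) => g x) hrep
    simp only [conv_apply, mulS_apply, reflect_apply] at h1
    rw [conv_apply, smul_apply, SchwartzMap.compSubConstCLM_apply, smul_eq_mul, ← h1]
    congr 1 with z
    rw [mulS_apply, reflect_apply]
    ring
  rw [hconv, map_smul, smul_eq_mul]

theorem integrable_inv_one_add_norm_pow :
    Integrable fun u : E => ((1 + ‖u‖) ^ (Module.finrank ℝ E + 1))⁻¹ := by
  have h := integrable_one_add_norm (E := E) (μ := volume)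
    (r := ((Module.finrank ℝ E + 1 : ℕ) : ℝ)) (by push_cast; linarith)
  refine h.congr (Filter.Eventually.of_forall fun u => ?_)
  change (1 + ‖u‖) ^ (-((Module.finrank ℝ E + 1 : ℕ) : ℝ)) = _
  rw [Real.rpow_neg (by positivity), Real.rpow_natCast]

/-- The oscillation at scale `L / a` of the dilated kernel is dominated by an integrable
function whose integral is small with `L`. -/
theorem exists_osc_bound (K : 𝓢(E, ℂ)) : ∃ C : ℝ, 0 ≤ C ∧ ∀ (a : ℝ) (ha : 0 < a) (L : ℝ),
    0 ≤ L → ∃ H : E → ℝ≥0∞, Measurable H ∧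
      ∫⁻ u, H u = ENNReal.ofReal (C * L * (1 + L) ^ (Module.finrank ℝ E + 1)) ∧
      ∀ u v, ‖u - v‖ ≤ L / a → ‖dilateL1 a ha K u - dilateL1 a ha K v‖ₑ ≤ H v := by
  -- The weight `finrank + 1` makes the resulting majorant integrable. Its `L¹`-normalized dilation
  -- below has an integral independent of `a`.
  obtain ⟨C, hC, hb⟩ := exists_norm_sub_le K (Module.finrank ℝ E + 1)
  set d := Module.finrank ℝ E with hd
  set h : E → ℝ := fun u => ((1 + ‖u‖) ^ (d + 1))⁻¹ with hh
  have hhint : Integrable h := integrable_inv_one_add_norm_pow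
  have hhpos : ∀ u, 0 ≤ h u := fun u => by positivity
  refine ⟨C * ∫ u, h u, mul_nonneg hC (integral_nonneg hhpos), fun a ha L hL =>
    ⟨fun u => ENNReal.ofReal (a ^ d * (C * L * (1 + L) ^ (d + 1)) * h (a • u)), ?_, ?_, ?_⟩⟩
  · have : Continuous h := by
      refine Continuous.inv₀ (by fun_prop) fun u => by positivity
    fun_prop
  · rw [← ofReal_integral_eq_lintegral_ofReal]
    · rw [integral_const_mul, Measure.integral_comp_smul, abs_of_pos (by positivity), ← hd,
        smul_eq_mul]
      congr 1
      field_simp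
    · exact (hhint.comp_smul ha.ne').const_mul _
    · exact Filter.Eventually.of_forall fun u => mul_nonneg (by positivity) (hhpos _)
  · intro u v huv
    rw [← ofReal_norm]
    apply ENNReal.ofReal_le_ofReal
    rw [dilateL1_apply, dilateL1_apply, ← mul_sub, norm_mul, norm_real,
      Real.norm_of_nonneg (by positivity), mul_assoc]
    gcongr
    have h1 := hb (a • u) (a • v)
    have h2 : ‖a • u - a • v‖ ≤ L := by
      rw [← smul_sub, norm_smul, Real.norm_of_nonneg ha.le]
      rw [le_div_iff₀ ha] at huv
      linarith
    rw [hh]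
    simp only
    rw [← div_eq_mul_inv, le_div_iff₀ (by positivity), mul_comm]
    refine h1.trans ?_
    gcongr

/-- Sampling inequalities for the transform `x ↦ ⟨f, P(· - x)⟩` of a tempered distribution,
uniformly over windows with frequency support in a ball of radius `a R`. -/
theorem exists_sampling (R : ℝ) (hR : 0 < R) : ∃ C : ℝ, 0 ≤ C ∧
    ∀ (a : ℝ), 0 < a → ∀ (L : ℝ), 0 ≤ L → ∀ (P : 𝓢(E, ℂ)) (ω : E),
      (∀ η, 𝓕 P η ≠ 0 → ‖η - ω‖ ≤ a * R) → ∀ (f : 𝓢'(E, ℂ)),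
      (∀ {ι : Type} [Countable ι] (x : ι → E) (N : ℕ),
        (∀ y, {j | ‖y - x j‖ ≤ L / a}.encard ≤ N) →
        volume (Metric.closedBall (0 : E) (L / a)) * ∑' j, ‖f (translate (x j) P)‖ₑ ^ 2 ≤
          N * (2 + 2 * ENNReal.ofReal (C * L * (1 + L) ^ (Module.finrank ℝ E + 1)) ^ 2) *
            ∫⁻ y, ‖f (translate y P)‖ₑ ^ 2) ∧
      (C * L * (1 + L) ^ (Module.finrank ℝ E + 1) ≤ 1 / 2 →
        ∀ {ι : Type} [Countable ι] (x : ι → E), (∀ y, ∃ j, ‖y - x j‖ ≤ L / a) →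
        ∫⁻ y, ‖f (translate y P)‖ₑ ^ 2 ≤
          4 * (volume (Metric.closedBall (0 : E) (L / a)) *
            ∑' j, ‖f (translate (x j) P)‖ₑ ^ 2)) := by
  -- The extra `1` in the radius leaves room for the band of the cutoffs `q n`, which is `a` wide.
  obtain ⟨K, hK, -, -⟩ := exists_kernel (E := E) (R + 1) (by linarith)
  obtain ⟨C, hC, hosc⟩ := exists_osc_bound K
  refine ⟨C, hC, fun a ha L hL P ω hP f => ?_⟩
  obtain ⟨H, hHm, hHint, hH⟩ := hosc a ha L hL
  obtain ⟨q, hq, hq1, hqlim⟩ := exists_modulated_cutoffs ω ha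
  set κ := ENNReal.ofReal (C * L * (1 + L) ^ (Module.finrank ℝ E + 1)) with hκ
  let F : ℕ → E → ℂ := fun n y => q n y * f (translate y P)
  have hFc : ∀ n, Continuous (F n) := fun n =>
    (q n).continuous.mul (continuous_apply_translate f P)
  have hFm : ∀ n, Measurable (F n) := fun n => (hFc n).measurable
  have hFle : ∀ n y, ‖F n y‖ₑ ^ 2 ≤ ‖f (translate y P)‖ₑ ^ 2 := fun n y => by
    refine pow_le_pow_left₀ zero_le ?_ 2
    rw [← ofReal_norm, ← ofReal_norm]
    apply ENNReal.ofReal_le_ofReal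
    rw [norm_mul]
    exact mul_le_of_le_one_left (norm_nonneg _) (hq1 n y)
  have hFlim : ∀ y, Filter.Tendsto (fun n => ‖F n y‖ₑ ^ 2) Filter.atTop
      (nhds (‖f (translate y P)‖ₑ ^ 2)) := fun y => by
    have h1 : Filter.Tendsto (fun n => ‖F n y‖) Filter.atTop (nhds ‖f (translate y P)‖) := by
      have := (hqlim y).mul_const ‖f (translate y P)‖
      rw [one_mul] at this
      refine this.congr fun n => (norm_mul _ _).symm
    have h2 := (ENNReal.continuous_ofReal.tendsto _).comp h1
    have h3 := ((ENNReal.continuous_pow 2).tendsto _).comp h2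
    rw [ofReal_norm] at h3
    refine h3.congr fun n => ?_
    simp only [Function.comp_apply, ofReal_norm]
  let G : ℕ → E → ℝ≥0∞ := fun n y => ∫⁻ z, ‖F n z‖ₑ * H (y - z)
  have hGm : ∀ n, Measurable (G n) := fun n => by
    apply Measurable.lintegral_prod_right' (f := fun p : E × E => ‖F n p.2‖ₑ * H (p.1 - p.2))
    have := hFm n
    fun_prop
  have hG : ∀ n, ∫⁻ y, G n y ^ 2 ≤ κ ^ 2 * ∫⁻ y, ‖F n y‖ₑ ^ 2 := fun n => by
    have := lintegral_conv_sq_le volume (f := fun z => ‖F n z‖ₑ) (h := H)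
      (by have := hFm n; fun_prop) hHm
    rwa [hHint] at this
  have hdiff : ∀ n x y, ‖x - y‖ ≤ L / a → ‖F n x - F n y‖ₑ ≤ G n y := by
    intro n x y hxy
    have hrx := mul_apply_translate_eq_integral ha hK hP (hq n) f x
    have hry := mul_apply_translate_eq_integral ha hK hP (hq n) f y
    simp only [F, hrx, hry]
    rw [← integral_sub (integrable_mul_apply_translate f _ P)
      (integrable_mul_apply_translate f _ P)]
    refine (enorm_integral_le_lintegral_enorm _).trans (lintegral_mono fun z => ?_)
    simp only [mulS_apply, reflect_apply]
    rw [← sub_mul, ← sub_mul, mul_assoc, enorm_mul, mul_comm]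
    gcongr
    exact hH _ _ (by rwa [sub_sub_sub_cancel_right])
  have hlow : ∀ n x y, ‖x - y‖ ≤ L / a → ‖F n y‖ₑ ≤ ‖F n x‖ₑ + G n y := by
    intro n x y hxy
    have h1 : F n y = F n x - (F n x - F n y) := by ring
    calc ‖F n y‖ₑ = ‖F n x - (F n x - F n y)‖ₑ := by rw [← h1]
      _ ≤ ‖F n x‖ₑ + ‖F n x - F n y‖ₑ := enorm_sub_le
      _ ≤ _ := by gcongr; exact hdiff n x y hxy
  have hup : ∀ n x y, ‖x - y‖ ≤ L / a → ‖F n x‖ₑ ≤ ‖F n y‖ₑ + G n y := by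
    intro n x y hxy
    have h1 : F n x = F n y + (F n x - F n y) := by ring
    calc ‖F n x‖ₑ = ‖F n y + (F n x - F n y)‖ₑ := by rw [← h1]
      _ ≤ ‖F n y‖ₑ + ‖F n x - F n y‖ₑ := enorm_add_le _ _
      _ ≤ _ := by gcongr; exact hdiff n x y hxy
  refine ⟨fun {ι} _ x N hN => ?_, fun hL2 {ι} _ x hcov => ?_⟩
  · set B := N * (2 + 2 * κ ^ 2) * ∫⁻ y, ‖f (translate y P)‖ₑ ^ 2 with hB
    have hn : ∀ n, ∑' j, volume (Metric.closedBall (0 : E) (L / a)) * ‖F n (x j)‖ₑ ^ 2 ≤ B := by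
      intro n
      rw [ENNReal.tsum_mul_left]
      refine (tsum_sample_sq_le volume hN (hFm n) (hGm n) (hup n)).trans ?_
      rw [hB, mul_assoc]
      gcongr
      rw [add_mul, mul_assoc]
      have h1 : ∫⁻ y, ‖F n y‖ₑ ^ 2 ≤ ∫⁻ y, ‖f (translate y P)‖ₑ ^ 2 :=
        lintegral_mono (hFle n)
      gcongr
      exact (hG n).trans (by gcongr)
    -- The bound is uniform in `n`; it passes to the limit on each finite partial sum.
    rw [← ENNReal.tsum_mul_left, ENNReal.tsum_eq_iSup_sum]
    refine iSup_le fun s => ?_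
    have hlim : Filter.Tendsto
        (fun n => ∑ j ∈ s, volume (Metric.closedBall (0 : E) (L / a)) * ‖F n (x j)‖ₑ ^ 2)
        Filter.atTop (nhds (∑ j ∈ s, volume (Metric.closedBall (0 : E) (L / a)) *
          ‖f (translate (x j) P)‖ₑ ^ 2)) :=
      tendsto_finsetSum s fun j _ => ENNReal.Tendsto.const_mul (hFlim (x j))
        (Or.inr measure_closedBall_lt_top.ne)
    exact le_of_tendsto' hlim fun n => (ENNReal.sum_le_tsum s).trans (hn n)
  · have hκ2 : 2 * κ ^ 2 ≤ 1 / 2 := by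
      have h1 : κ ≤ ENNReal.ofReal (1 / 2) := ENNReal.ofReal_le_ofReal hL2
      have h2 : ENNReal.ofReal (1 / 2) = 1 / 2 := by
        rw [ENNReal.ofReal_div_of_pos (by norm_num)]; norm_num
      rw [h2] at h1
      calc 2 * κ ^ 2 ≤ 2 * (1 / 2) ^ 2 := by gcongr
        _ = 2 * (1 / 2) * (1 / 2) := by ring
        _ = 1 / 2 := by
          rw [ENNReal.mul_div_cancel (by norm_num) (by norm_num), one_mul]
    set B := 4 * (volume (Metric.closedBall (0 : E) (L / a)) *
            ∑' j, ‖f (translate (x j) P)‖ₑ ^ 2) with hB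
    have hn : ∀ n, ∫⁻ y, ‖F n y‖ₑ ^ 2 ≤ B := by
      intro n
      set I := ∫⁻ y, ‖F n y‖ₑ ^ 2 with hI
      have hIfin : I ≠ ∞ := (lintegral_mul_apply_translate_sq_lt_top f (q n) P).ne
      set S := volume (Metric.closedBall (0 : E) (L / a)) *
            ∑' j, ‖f (translate (x j) P)‖ₑ ^ 2 with hS
      have h1 : I ≤ 2 * S + 1 / 2 * I := by
        refine (lintegral_sq_le_tsum_sample volume hcov (hGm n) (hlow n)).trans ?_
        refine add_le_add ?_ ?_
        · rw [hS]
          exact mul_le_mul le_rfl (mul_le_mul le_rfl (ENNReal.tsum_le_tsum fun j => hFle n (x j))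
            zero_le zero_le) zero_le zero_le
        · calc 2 * ∫⁻ y, G n y ^ 2 ≤ 2 * (κ ^ 2 * I) := by gcongr; exact hG n
            _ = 2 * κ ^ 2 * I := by ring
            _ ≤ _ := by gcongr
      have h2 : 1 / 2 * I + 1 / 2 * I = I := by
        rw [← add_mul, one_div, ENNReal.inv_two_add_inv_two, one_mul]
      have h3 : 1 / 2 * I ≤ 2 * S := by
        have hfin : 1 / 2 * I ≠ ∞ := ENNReal.mul_ne_top (by norm_num) hIfin
        have h4 : 1 / 2 * I + 1 / 2 * I ≤ 2 * S + 1 / 2 * I := by rwa [h2]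
        exact (ENNReal.add_le_add_iff_right hfin).1 h4
      calc I = 1 / 2 * I + 1 / 2 * I := h2.symm
        _ ≤ 2 * S + 2 * S := add_le_add h3 h3
        _ = B := by rw [hB]; ring
    -- Fatou's lemma removes the cutoffs, giving the bound for `f` itself with no integrability
    -- assumed.
    calc ∫⁻ y, ‖f (translate y P)‖ₑ ^ 2
        = ∫⁻ y, Filter.liminf (fun n => ‖F n y‖ₑ ^ 2) Filter.atTop := by
          congr 1 with y
          exact (hFlim y).liminf_eq.symm
      _ ≤ Filter.liminf (fun n => ∫⁻ y, ‖F n y‖ₑ ^ 2) Filter.atTop :=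
          lintegral_liminf_le fun n => by have := hFm n; fun_prop
      _ ≤ B := Filter.liminf_le_of_le (by isBoundedDefault) fun b hb => by
          obtain ⟨n, hn'⟩ := hb.exists
          exact hn'.trans (hn n)

end Bandlimited

/-! ### Counting and covering for subdyadic lattices -/

section Geometry

theorem rpow_mem_Icc_of_mem_Icc {c u : ℝ} (hc : 1 ≤ c) (hu : c⁻¹ ≤ u) (hu' : u ≤ c) (β : ℝ) :
    (c ^ |β|)⁻¹ ≤ u ^ β ∧ u ^ β ≤ c ^ |β| := by
  have hc0 : 0 < c := by linarith
  have hu0 : 0 < u := lt_of_lt_of_le (inv_pos.2 hc0) hu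
  have key : ∀ {v : ℝ}, c⁻¹ ≤ v → v ≤ c → (c ^ |β|)⁻¹ ≤ v ^ |β| ∧ v ^ |β| ≤ c ^ |β| := by
    intro v hv hv'
    refine ⟨?_, Real.rpow_le_rpow ((inv_pos.2 hc0).le.trans hv) hv' (abs_nonneg _)⟩
    rw [← Real.inv_rpow hc0.le]
    exact Real.rpow_le_rpow (inv_pos.2 hc0).le hv (abs_nonneg _)
  rcases le_total 0 β with h | h
  · have := key hu hu'
    rwa [abs_of_nonneg h] at this ⊢
  · have h1 := key (v := u⁻¹) (inv_anti₀ hu0 hu') ((inv_le_comm₀ hu0 hc0).2 hu)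
    have h2 : u⁻¹ ^ |β| = u ^ β := by
      rw [abs_of_nonpos h, Real.inv_rpow hu0.le, ← Real.rpow_neg hu0.le, neg_neg]
    rwa [h2] at h1

section Counting

variable {E : Type*} [NormedAddCommGroup E] [NormedSpace ℝ E] [FiniteDimensional ℝ E]
  [MeasurableSpace E] [BorelSpace E]

/-- A family of balls of radius at least `r` with overlap at most `N` has at most
`N ((R + r) / r) ^ d` members with centre in a ball of radius `R`. -/
theorem card_le_of_overlap {ι : Type*} {c : ι → E} {s : ι → ℝ} {r R : ℝ} (hr : 0 < r) (hR : 0 ≤ R)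
    {N : ℕ} (hN : ∀ y, {i | ‖y - c i‖ ≤ s i}.encard ≤ N) {η : E} (T : Finset ι)
    (hs : ∀ i ∈ T, r ≤ s i) (hc : ∀ i ∈ T, ‖η - c i‖ ≤ R) :
    (T.card : ℝ) ≤ N * ((R + r) / r) ^ Module.finrank ℝ E := by
  let μ : Measure E := Measure.addHaar
  have h1 : (T.card : ℝ≥0∞) * μ (Metric.closedBall 0 r) ≤
      N * μ (Metric.closedBall η (R + r)) := by
    calc (T.card : ℝ≥0∞) * μ (Metric.closedBall 0 r)
        = ∑ i ∈ T, ∫⁻ y, (Metric.closedBall (c i) r).indicator (fun _ => 1) y ∂μ := by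
          rw [← nsmul_eq_mul, ← Finset.sum_const]
          refine Finset.sum_congr rfl fun i _ => ?_
          rw [lintegral_indicator_const Metric.isClosed_closedBall.measurableSet,
            Measure.addHaar_closedBall_center μ (c i), one_mul]
      _ = ∫⁻ y, ∑ i ∈ T, (Metric.closedBall (c i) r).indicator (fun _ => 1) y ∂μ := by
          rw [lintegral_finsetSum]
          intro i _
          exact measurable_const.indicator Metric.isClosed_closedBall.measurableSet
      _ ≤ ∫⁻ y, (Metric.closedBall η (R + r)).indicator (fun _ => (N : ℝ≥0∞)) y ∂μ := by
          refine lintegral_mono fun y => ?_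
          by_cases hy : y ∈ Metric.closedBall η (R + r)
          · rw [Set.indicator_of_mem hy]
            have h2 : ∀ i ∈ T, (Metric.closedBall (c i) r).indicator (fun _ => (1 : ℝ≥0∞)) y =
                if ‖y - c i‖ ≤ r then 1 else 0 := by
              intro i _
              simp [Set.indicator, dist_eq_norm]
            rw [Finset.sum_congr rfl h2, Finset.sum_boole]
            have h3 : ((T.filter fun i => ‖y - c i‖ ≤ r : Finset ι) : Set ι).encard ≤ N := by
              refine (Set.encard_le_encard ?_).trans (hN y)
              intro i hi
              have hi' := Finset.mem_filter.1 (Finset.mem_coe.1 hi)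
              exact hi'.2.trans (hs i hi'.1)
            rw [Set.encard_coe_eq_coe_finsetCard] at h3
            exact Nat.cast_le.2 (by exact_mod_cast h3)
          · rw [Finset.sum_eq_zero]
            · exact zero_le
            · intro i hi
              rw [Set.indicator_of_notMem]
              intro hyi
              apply hy
              rw [Metric.mem_closedBall, dist_eq_norm] at hyi ⊢
              have := norm_add_le (y - c i) (-(η - c i))
              rw [norm_neg, show y - c i + -(η - c i) = y - η by abel] at this
              linarith [hc i hi]
      _ = _ := by
          rw [lintegral_indicator_const Metric.isClosed_closedBall.measurableSet]
  rw [Measure.addHaar_closedBall μ _ hr.le, Measure.addHaar_closedBall μ _ (by linarith)] at h1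
  have hb0 : μ (Metric.ball 0 1) ≠ 0 := (Metric.measure_ball_pos μ 0 one_pos).ne'
  have hbt : μ (Metric.ball 0 1) ≠ ∞ := measure_ball_lt_top.ne
  rw [← mul_assoc, ← mul_assoc, ENNReal.mul_le_mul_iff_left hb0 hbt] at h1
  rw [← ENNReal.ofReal_natCast, ← ENNReal.ofReal_natCast, ← ENNReal.ofReal_mul (by positivity),
    ← ENNReal.ofReal_mul (by positivity), ENNReal.ofReal_le_ofReal_iff (by positivity)] at h1
  rw [div_pow, ← mul_div_assoc, le_div_iff₀ (by positivity)]
  exact h1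

end Counting

variable {d : ℕ} {α ρ : ℝ}

local notation "𝔼" => EuclideanSpace ℝ (Fin d)

theorem scale_pos (ξ : 𝔼) : 0 < scale α ξ :=
  Real.rpow_pos_of_pos (lt_of_lt_of_le one_pos (le_max_left _ _)) _

/-- For each `k` some spatial ball contains `y = 0`. Picking one such `j k` embeds the frequency
balls through `η` into the blocks through `(0, η)`. -/
theorem Lattice.freq_overlap (Ω : Lattice d α ρ) : ∃ N : ℕ, ∀ η : 𝔼,
    {k | ‖η - Ω.freq k‖ ≤ ρ * scale α (Ω.freq k)}.encard ≤ N := by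
  obtain ⟨N, hN⟩ := Ω.finite_overlap
  choose j hj using fun k => Ω.pos_cover k 0
  refine ⟨N, fun η => le_trans ?_ (hN (0, η))⟩
  rw [← Set.InjOn.encard_image (f := fun k => (k, j k)) (fun a _ b _ h => congrArg Prod.fst h)]
  refine Set.encard_le_encard ?_
  rintro _ ⟨k, hk, rfl⟩
  exact ⟨hj k, hk⟩

theorem Lattice.pos_overlap (Ω : Lattice d α ρ) (hρ : 0 ≤ ρ) : ∃ N : ℕ, ∀ k, ∀ y : 𝔼,
    {j | ‖y - Ω.pos k j‖ ≤ ρ * (scale α (Ω.freq k))⁻¹}.encard ≤ N := by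
  obtain ⟨N, hN⟩ := Ω.finite_overlap
  refine ⟨N, fun k y => le_trans ?_ (hN (y, Ω.freq k))⟩
  rw [← Set.InjOn.encard_image (f := fun j => (k, j)) (fun a _ b _ h => congrArg Prod.snd h)]
  refine Set.encard_le_encard ?_
  rintro _ ⟨j, hj, rfl⟩
  refine ⟨hj, ?_⟩
  change ‖Ω.freq k - Ω.freq k‖ ≤ _
  rw [sub_self, norm_zero]
  exact mul_nonneg hρ (scale_pos _).le

/-- Centres in a bounded region have radii bounded below, so the volume count bounds the size of
every finite set of them. -/
theorem Lattice.finite_low (Ω : Lattice d α ρ) (hρ : 0 < ρ) (K : ℝ) :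
    {k | ‖Ω.freq k‖ < K}.Finite := by
  obtain ⟨N, hN⟩ := Ω.freq_overlap
  set K' := max 1 K with hK'
  have hK1 : 1 ≤ K' := le_max_left _ _
  have hpos : 0 < (K' ^ |1 - α|)⁻¹ := inv_pos.2 (Real.rpow_pos_of_pos (by linarith) _)
  have hr : 0 < ρ * (K' ^ |1 - α|)⁻¹ := by positivity
  by_contra hinf
  have hinf : {k | ‖Ω.freq k‖ < K}.Infinite := hinf
  obtain ⟨n, hn⟩ := exists_nat_gt
    ((N : ℝ) * ((K' + ρ * (K' ^ |1 - α|)⁻¹) / (ρ * (K' ^ |1 - α|)⁻¹)) ^ Module.finrank ℝ 𝔼)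
  obtain ⟨T, hT, hTc⟩ := hinf.exists_subset_card_eq n
  have h := card_le_of_overlap (R := K') hr (by linarith) hN (η := 0) T (fun k hk => ?_) (fun k hk => ?_)
  · rw [hTc] at h
    linarith
  · have h1 : ‖Ω.freq k‖ < K := hT hk
    have h2 := (rpow_mem_Icc_of_mem_Icc hK1 (u := max 1 ‖Ω.freq k‖)
      ((inv_le_one_of_one_le₀ hK1).trans (le_max_left _ _))
      (max_le hK1 (h1.le.trans (le_max_right _ _))) (1 - α)).1
    exact mul_le_mul_of_nonneg_left h2 hρ.le
  · have h1 : ‖Ω.freq k‖ < K := hT hk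
    rw [zero_sub, norm_neg]
    exact h1.le.trans (le_max_right _ _)

/-- The enlarged frequency balls of a subdyadic lattice have bounded overlap at high
frequencies. -/
theorem Lattice.exists_high_overlap (Ω : Lattice d α ρ) (hα : 0 < α) (hρ : 0 < ρ) {R : ℝ}
    (hR : 0 < R) : ∃ K : ℝ, 1 ≤ K ∧ ∃ N : ℝ, 0 ≤ N ∧ ∀ (η : 𝔼) (T : Finset ℕ),
      (∀ k ∈ T, K ≤ ‖Ω.freq k‖ ∧ ‖η - Ω.freq k‖ ≤ R * ‖Ω.freq k‖ ^ (1 - α)) →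
      (T.card : ℝ) ≤ N := by
  obtain ⟨N, hN⟩ := Ω.freq_overlap
  -- Beyond this height `R |ξ|^(1-α) ≤ |ξ| / 2`, so every centre counted has norm within a factor
  -- `2` of `|η|`, and all radii involved are comparable to `|η|^(1-α)`.
  set K := max 1 ((2 * R) ^ α⁻¹) with hK
  have hK1 : 1 ≤ K := le_max_left _ _
  set c := (2 : ℝ) ^ |1 - α| with hc
  have hcpos : 0 < c := by positivity
  refine ⟨K, hK1, N * ((R * c + ρ * c⁻¹) / (ρ * c⁻¹)) ^ Module.finrank ℝ 𝔼, by positivity,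
    fun η T hT => ?_⟩
  rcases T.eq_empty_or_nonempty with rfl | ⟨k₀, hk₀⟩
  · simp only [Finset.card_empty, Nat.cast_zero]
    positivity
  have hhalf : ∀ k ∈ T, R * ‖Ω.freq k‖ ^ (1 - α) ≤ ‖Ω.freq k‖ / 2 := by
    intro k hk
    have h1 := (hT k hk).1
    have hr : 0 < ‖Ω.freq k‖ := by linarith
    have h2 : 2 * R ≤ ‖Ω.freq k‖ ^ α := by
      calc 2 * R = ((2 * R) ^ α⁻¹) ^ α := by
            rw [← Real.rpow_mul (by positivity), inv_mul_cancel₀ hα.ne', Real.rpow_one]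
        _ ≤ _ := Real.rpow_le_rpow (by positivity) ((le_max_right _ _).trans h1) hα.le
    rw [Real.rpow_sub hr, Real.rpow_one, ← mul_div_assoc,
      div_le_iff₀ (Real.rpow_pos_of_pos hr _)]
    nlinarith
  have hS : ∀ k ∈ T, ‖Ω.freq k‖ / 2 ≤ ‖η‖ ∧ ‖η‖ ≤ 3 / 2 * ‖Ω.freq k‖ := by
    intro k hk
    have h1 := (hT k hk).2.trans (hhalf k hk)
    have h2 := norm_sub_norm_le (Ω.freq k) η
    have h3 := norm_sub_norm_le η (Ω.freq k)
    rw [norm_sub_rev] at h2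
    constructor <;> linarith
  have hη : 0 < ‖η‖ := by
    have h1 := (hS k₀ hk₀).1
    have h2 := (hT k₀ hk₀).1
    linarith
  have hratio : ∀ k ∈ T, c⁻¹ * ‖η‖ ^ (1 - α) ≤ ‖Ω.freq k‖ ^ (1 - α) ∧
      ‖Ω.freq k‖ ^ (1 - α) ≤ c * ‖η‖ ^ (1 - α) := by
    intro k hk
    have h1 := rpow_mem_Icc_of_mem_Icc (c := 2) (u := ‖Ω.freq k‖ / ‖η‖) (by norm_num)
      (by rw [le_div_iff₀ hη]; linarith [(hS k hk).2])
      (by rw [div_le_iff₀ hη]; linarith [(hS k hk).1]) (1 - α)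
    have hp : 0 < ‖η‖ ^ (1 - α) := Real.rpow_pos_of_pos hη _
    rw [Real.div_rpow (norm_nonneg _) hη.le, le_div_iff₀ hp, div_le_iff₀ hp] at h1
    exact h1
  have hp : 0 < ‖η‖ ^ (1 - α) := Real.rpow_pos_of_pos hη _
  have h := card_le_of_overlap (r := ρ * (c⁻¹ * ‖η‖ ^ (1 - α))) (R := R * (c * ‖η‖ ^ (1 - α)))
    (by positivity) (by positivity) hN (η := η) T (fun k hk => ?_) (fun k hk => ?_)
  · refine h.trans (le_of_eq ?_)
    congr 2
    field_simp
  · rw [scale, max_eq_right (hK1.trans (hT k hk).1)]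
    exact mul_le_mul_of_nonneg_left (hratio k hk).1 hρ.le
  · exact (hT k hk).2.trans (mul_le_mul_of_nonneg_left (hratio k hk).2 hR.le)

/-- Intermediate value theorem in `t`. For large `t` the left side is below `t`, since `t^(1-α) =
o(t)`. At `t₀` the points `t₀^(1-α) ζ₀` and `t₀^(1-α) ζ₁` are at least `2 t₀` apart, so `η` cannot
be within `t₀` of both. Having two candidates for `ζ` is what keeps `t` away from `0` uniformly in
`η`. -/
theorem exists_norm_sub_rpow_smul_eq (hα : 0 < α) {ζ₀ ζ₁ : 𝔼} (hne : ζ₀ ≠ ζ₁) :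
    ∃ t₀ : ℝ, 0 < t₀ ∧ t₀ ≤ 1 ∧ ∀ η : 𝔼, ∃ t, t₀ ≤ t ∧ ∃ ζ : 𝔼, (ζ = ζ₀ ∨ ζ = ζ₁) ∧
      ‖η - t ^ (1 - α) • ζ‖ = t := by
  set D := ‖ζ₀ - ζ₁‖ with hD
  have hDpos : 0 < D := norm_pos_iff.2 (sub_ne_zero.2 hne)
  set t₀ := min 1 ((D / 2) ^ α⁻¹) with ht₀
  have ht₀pos : 0 < t₀ := lt_min one_pos (by positivity)
  have ht₀α : t₀ ^ α ≤ D / 2 := by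
    calc t₀ ^ α ≤ ((D / 2) ^ α⁻¹) ^ α :=
          Real.rpow_le_rpow ht₀pos.le (min_le_right _ _) hα.le
      _ = D / 2 := by
        rw [← Real.rpow_mul (by positivity), inv_mul_cancel₀ hα.ne', Real.rpow_one]
  refine ⟨t₀, ht₀pos, min_le_left _ _, fun η => ?_⟩
  have hstart : ∃ ζ : 𝔼, (ζ = ζ₀ ∨ ζ = ζ₁) ∧ t₀ ≤ ‖η - t₀ ^ (1 - α) • ζ‖ := by
    by_contra hcon
    push Not at hcon
    have h0 := hcon ζ₀ (Or.inl rfl)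
    have h1 := hcon ζ₁ (Or.inr rfl)
    have h2 := norm_sub_le (η - t₀ ^ (1 - α) • ζ₁) (η - t₀ ^ (1 - α) • ζ₀)
    rw [show η - t₀ ^ (1 - α) • ζ₁ - (η - t₀ ^ (1 - α) • ζ₀) = t₀ ^ (1 - α) • (ζ₀ - ζ₁) by
      rw [smul_sub]; abel, norm_smul, Real.norm_of_nonneg (by positivity), ← hD] at h2
    have h3 : t₀ ^ (1 - α) * D < 2 * t₀ := by linarith
    rw [Real.rpow_sub ht₀pos, Real.rpow_one] at h3
    have hp : 0 < t₀ ^ α := by positivity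
    rw [div_mul_eq_mul_div, div_lt_iff₀ hp] at h3
    nlinarith
  obtain ⟨ζ, hζ, hζ₀⟩ := hstart
  set T := max t₀ (max (2 * ‖η‖) ((2 * ‖ζ‖) ^ α⁻¹)) with hT
  have hTpos : 0 < T := lt_of_lt_of_le ht₀pos (le_max_left _ _)
  have hend : ‖η - T ^ (1 - α) • ζ‖ ≤ T := by
    have h1 : 2 * ‖η‖ ≤ T := (le_max_left _ _).trans (le_max_right _ _)
    have h2 : 2 * ‖ζ‖ ≤ T ^ α := by
      calc 2 * ‖ζ‖ = ((2 * ‖ζ‖) ^ α⁻¹) ^ α := by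
            rw [← Real.rpow_mul (by positivity), inv_mul_cancel₀ hα.ne', Real.rpow_one]
        _ ≤ _ := Real.rpow_le_rpow (by positivity)
          ((le_max_right _ _).trans (le_max_right _ _)) hα.le
    have h3 : T ^ (1 - α) * ‖ζ‖ ≤ T / 2 := by
      rw [Real.rpow_sub hTpos, Real.rpow_one, div_mul_eq_mul_div,
        div_le_iff₀ (Real.rpow_pos_of_pos hTpos _)]
      nlinarith
    have h4 := norm_sub_le η (T ^ (1 - α) • ζ)
    rw [norm_smul, Real.norm_of_nonneg (by positivity)] at h4
    linarith
  have hcont : ContinuousOn (fun t : ℝ => ‖η - t ^ (1 - α) • ζ‖ - t) (Set.Icc t₀ T) := by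
    have h1 : ContinuousOn (fun t : ℝ => t ^ (1 - α)) (Set.Icc t₀ T) := fun t ht =>
      (Real.continuousAt_rpow_const t (1 - α)
        (Or.inl (lt_of_lt_of_le ht₀pos ht.1).ne')).continuousWithinAt
    exact ((continuousOn_const.sub (h1.smul continuousOn_const)).norm).sub continuousOn_id
  obtain ⟨t, ht, hteq⟩ := intermediate_value_Icc' (le_max_left _ _ : t₀ ≤ T) hcont
    (show (0 : ℝ) ∈ Set.Icc _ _ from ⟨sub_nonpos.2 hend, sub_nonneg.2 hζ₀⟩)
  exact ⟨t, ht.1, ζ, hζ, sub_eq_zero.1 hteq⟩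

/-- For small mesh, every frequency is seen by a packet of a subdyadic lattice whose centre is
bounded away from the origin. -/
theorem exists_frequency_cover (hα : 0 < α) {Z : 𝔼 → ℂ} (hZ : Continuous Z) {ζ₀ : 𝔼}
    (hζ₀ : ζ₀ ≠ 0) (hZζ : Z ζ₀ ≠ 0) : ∃ ρ₀ c₁ c : ℝ, 0 < ρ₀ ∧ 0 < c₁ ∧ c₁ ≤ 1 ∧ 0 < c ∧
      ∀ ρ : ℝ, 0 < ρ → ρ ≤ ρ₀ → ∀ freq : ℕ → 𝔼,
        (∀ η : 𝔼, ∃ k, ‖η - freq k‖ ≤ ρ * scale α (freq k)) →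
        ∀ η : 𝔼, ∃ k, c₁ ≤ ‖freq k‖ ∧ c ≤ ‖Z ((‖freq k‖ ^ (1 - α))⁻¹ • (η - freq k))‖ := by
  have hc : 0 < ‖Z ζ₀‖ / 2 := by positivity
  obtain ⟨r, hr, hball⟩ : ∃ r > 0, ∀ ζ : 𝔼, ‖ζ - ζ₀‖ < r → ‖Z ζ₀‖ / 2 ≤ ‖Z ζ‖ := by
    have h1 : ∀ᶠ ζ in nhds ζ₀, ‖Z ζ₀‖ / 2 < ‖Z ζ‖ :=
      (hZ.norm.tendsto ζ₀).eventually (lt_mem_nhds (by linarith))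
    obtain ⟨r, hr, h⟩ := Metric.eventually_nhds_iff.1 h1
    exact ⟨r, hr, fun ζ hζ => (h (by rwa [dist_eq_norm])).le⟩
  set ζ₁ : 𝔼 := ζ₀ + (r / 2 / ‖ζ₀‖) • ζ₀ with hζ₁
  have hn : ‖(r / 2 / ‖ζ₀‖) • ζ₀‖ = r / 2 := by
    rw [norm_smul, Real.norm_of_nonneg (by positivity),
      div_mul_cancel₀ _ (norm_ne_zero_iff.2 hζ₀)]
  have hne : ζ₀ ≠ ζ₁ := by
    intro h
    have h2 : (r / 2 / ‖ζ₀‖) • ζ₀ = 0 := by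
      have := h
      rw [hζ₁] at this
      exact left_eq_add.1 this
    rw [h2, norm_zero] at hn
    linarith
  have hnear : ∀ ζ : 𝔼, ζ = ζ₀ ∨ ζ = ζ₁ → ‖ζ - ζ₀‖ ≤ r / 2 ∧ ‖ζ‖ ≤ ‖ζ₀‖ + r / 2 := by
    rintro ζ (rfl | rfl)
    · rw [sub_self, norm_zero]
      constructor <;> linarith
    · refine ⟨by rw [hζ₁, add_sub_cancel_left, hn], ?_⟩
      have := norm_add_le ζ₀ ((r / 2 / ‖ζ₀‖) • ζ₀)
      rwa [hn] at this
  obtain ⟨t₀, ht₀, ht₀1, hsol⟩ := exists_norm_sub_rpow_smul_eq hα hne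
  set M := ‖ζ₀‖ + r / 2 with hM
  have hMpos : 0 < M := by positivity
  obtain ⟨θ, hθ, hθc⟩ : ∃ θ > 0, ∀ u : ℝ, |u - 1| < θ → |u ^ (1 - α) - 1| ≤ r / (8 * M) := by
    have h1 := (Real.continuousAt_rpow_const 1 (1 - α) (Or.inl one_ne_zero)).tendsto
    rw [Real.one_rpow] at h1
    obtain ⟨θ, hθ, h⟩ := Metric.tendsto_nhds_nhds.1 h1 (r / (8 * M)) (by positivity)
    exact ⟨θ, hθ, fun u hu => (h (by rwa [Real.dist_eq])).le⟩
  set c₁ := t₀ / 2 with hc₁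
  have hc₁pos : 0 < c₁ := by positivity
  set C₁ := (c₁⁻¹) ^ |1 - α| with hC₁
  have hc₁inv : 1 ≤ c₁⁻¹ := (one_le_inv₀ hc₁pos).2 (by linarith)
  have hC₁pos : 0 < C₁ := by positivity
  -- The three bounds on `ρ` keep `|freq k|` above `t₀ / 2`, keep `t / |freq k|` within `θ` of `1`,
  -- and make `ξ - freq k` at most `r / 8` in units of `|freq k|^(1-α)`.
  refine ⟨min (t₀ / 4) (min (θ * c₁ / 2) (r / (8 * C₁))), c₁, ‖Z ζ₀‖ / 2, by positivity, hc₁pos,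
    by linarith, hc, fun ρ hρ hρ₀ freq hcov η => ?_⟩
  have hρ1 : ρ ≤ t₀ / 4 := hρ₀.trans (min_le_left _ _)
  have hρ2 : ρ ≤ θ * c₁ / 2 := hρ₀.trans ((min_le_right _ _).trans (min_le_left _ _))
  have hρ3 : ρ ≤ r / (8 * C₁) := hρ₀.trans ((min_le_right _ _).trans (min_le_right _ _))
  obtain ⟨t, ht, ζ, hζ, hteq⟩ := hsol η
  obtain ⟨hζ1, hζ2⟩ := hnear ζ hζ
  set ξ := η - t ^ (1 - α) • ζ with hξ
  obtain ⟨k, hk⟩ := hcov ξ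
  set s := ‖freq k‖ with hs
  have htpos : 0 < t := lt_of_lt_of_le ht₀ ht
  -- As `1 - α ≤ 1`, the scale grows at most linearly.
  have hscale : scale α (freq k) ≤ max 1 s := by
    rw [scale]
    calc (max 1 ‖freq k‖) ^ (1 - α) ≤ (max 1 ‖freq k‖) ^ (1 : ℝ) :=
          Real.rpow_le_rpow_of_exponent_le (le_max_left _ _) (by linarith)
      _ = _ := Real.rpow_one _
  have hdist : |t - s| ≤ ρ * max 1 s := by
    rw [← hteq]
    exact (abs_norm_sub_norm_le _ _).trans
      (hk.trans (mul_le_mul_of_nonneg_left hscale hρ.le))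
  have hsc : c₁ ≤ s := by
    by_contra hcon
    push Not at hcon
    rw [max_eq_left (by linarith), mul_one] at hdist
    have := (abs_le.1 hdist).2
    linarith
  have hspos : 0 < s := hc₁pos.trans_le hsc
  refine ⟨k, hsc, hball _ ?_⟩
  have hA : 0 < s ^ (1 - α) := Real.rpow_pos_of_pos hspos _
  have hmax : max 1 s ≤ c₁⁻¹ * s := by
    refine max_le ?_ (le_mul_of_one_le_left hspos.le hc₁inv)
    rw [← div_eq_inv_mul, le_div_iff₀ hc₁pos]
    linarith
  have hratio : |t / s - 1| < θ := by
    rw [div_sub_one hspos.ne', abs_div, abs_of_pos hspos, div_lt_iff₀ hspos]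
    calc |t - s| ≤ ρ * max 1 s := hdist
      _ ≤ θ * c₁ / 2 * (c₁⁻¹ * s) := by gcongr
      _ = θ * s / 2 := by field_simp
      _ < θ * s := by nlinarith
  have hsa : scale α (freq k) ≤ C₁ * s ^ (1 - α) := by
    have h1 := (rpow_mem_Icc_of_mem_Icc hc₁inv (u := max 1 s / s)
      (by
        rw [inv_inv, le_div_iff₀ hspos]
        exact (mul_le_of_le_one_left hspos.le (by linarith)).trans (le_max_right _ _))
      (by rwa [div_le_iff₀ hspos]) (1 - α)).2
    rw [Real.div_rpow (by positivity) hspos.le, div_le_iff₀ hA] at h1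
    exact h1
  -- The error has two sources: `freq k` in place of `ξ`, and the dilation `s^(1-α)` in place of
  -- `t^(1-α)`. Each costs `r / 8`, and `ζ` is within `r / 2` of `ζ₀`.
  have hdecomp : (s ^ (1 - α))⁻¹ • (η - freq k) - ζ =
      (s ^ (1 - α))⁻¹ • (ξ - freq k) + ((t / s) ^ (1 - α) - 1) • ζ := by
    rw [Real.div_rpow htpos.le hspos.le, hξ, sub_smul, one_smul, div_eq_inv_mul, mul_smul,
      smul_sub, smul_sub, smul_sub]
    abel
  have hfirst : ‖(s ^ (1 - α))⁻¹ • (ξ - freq k)‖ ≤ r / 8 := by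
    rw [norm_smul, norm_inv, Real.norm_of_nonneg hA.le, inv_mul_le_iff₀ hA]
    calc ‖ξ - freq k‖ ≤ ρ * scale α (freq k) := hk
      _ ≤ r / (8 * C₁) * (C₁ * s ^ (1 - α)) := by
        gcongr
        exact (scale_pos _).le
      _ = s ^ (1 - α) * (r / 8) := by field_simp
  have hsecond : ‖((t / s) ^ (1 - α) - 1) • ζ‖ ≤ r / 8 := by
    rw [norm_smul, Real.norm_eq_abs]
    calc _ ≤ r / (8 * M) * M := by gcongr; exact hθc _ hratio
      _ = r / 8 := by field_simp
  have h5 : (s ^ (1 - α))⁻¹ • (η - freq k) - ζ₀ =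
      ((s ^ (1 - α))⁻¹ • (η - freq k) - ζ) + (ζ - ζ₀) := by abel
  rw [h5, hdecomp]
  have h6 := norm_add_le ((s ^ (1 - α))⁻¹ • (ξ - freq k) + ((t / s) ^ (1 - α) - 1) • ζ) (ζ - ζ₀)
  have h7 := norm_add_le ((s ^ (1 - α))⁻¹ • (ξ - freq k)) (((t / s) ^ (1 - α) - 1) • ζ)
  linarith

end Geometry

/-! ### Duality and identification with `L²` -/

section Reconstruction

theorem lintegral_mul_le_sqrt {E : Type*} [MeasurableSpace E] {μ : Measure E} {f g : E → ℝ≥0∞}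
    (hf : AEMeasurable f μ) (hg : AEMeasurable g μ) :
    ∫⁻ x, f x * g x ∂μ ≤ (∫⁻ x, f x ^ 2 ∂μ) ^ (1 / 2 : ℝ) * (∫⁻ x, g x ^ 2 ∂μ) ^ (1 / 2 : ℝ) := by
  have h := ENNReal.lintegral_mul_le_Lp_mul_Lq μ Real.HolderConjugate.two_two hf hg
  simpa using h

variable {d : ℕ}

local notation "𝔼" => EuclideanSpace ℝ (Fin d)

/-- Near the support of `g` the division is smooth; elsewhere the quotient vanishes locally,
whatever value the inverse takes. -/
theorem exists_schwartz_div {g : 𝓢(𝔼, ℂ)} (hg : HasCompactSupport g) {m : 𝔼 → ℝ}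
    (hm : ContDiff ℝ (⊤ : ℕ∞) m) (hm0 : ∀ η ∈ tsupport g, m η ≠ 0) :
    ∃ u : 𝓢(𝔼, ℂ), ∀ η, u η = (m η)⁻¹ • g η := by
  have hsmooth : ContDiff ℝ (⊤ : ℕ∞) fun η => (m η)⁻¹ • g η := by
    rw [contDiff_iff_contDiffAt]
    intro η
    by_cases hη : η ∈ tsupport g
    · exact (hm.contDiffAt.inv (hm0 η hη)).smul (g.smooth ⊤).contDiffAt
    · have h0 : (fun η => (m η)⁻¹ • g η) =ᶠ[nhds η] fun _ => 0 := by
        filter_upwards [notMem_tsupport_iff_eventuallyEq.1 hη] with y hy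
        rw [hy]
        simp
      exact contDiffAt_const.congr_of_eventuallyEq h0
  have hsupp : HasCompactSupport fun η => (m η)⁻¹ • g η := hg.smul_left (f := fun η => (m η)⁻¹)
  exact ⟨hsupp.toSchwartzMap hsmooth, fun η => rfl⟩

/-- Duality estimate: a tempered distribution tested on a function with compact frequency support
is controlled by finitely many transforms whose windows cover that support. -/
theorem enorm_apply_sq_le (f : 𝓢'(𝔼, ℂ)) (P : ℕ → 𝓢(𝔼, ℂ)) {w : ℕ → ℝ} (hw : ∀ k, 0 < w k)
    (T : Finset ℕ) {c : ℝ} (hc : 0 < c) {g : 𝓢(𝔼, ℂ)}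
    (hg : HasCompactSupport (𝓕 g : 𝓢(𝔼, ℂ)))
    (hT : ∀ η ∈ tsupport (𝓕 g : 𝓢(𝔼, ℂ)), c ≤ ∑ k ∈ T, w k * ‖𝓕 (P k) η‖ ^ 2) :
    ‖f g‖ₑ ^ 2 ≤ (ENNReal.ofReal c)⁻¹ * (∫⁻ x, ‖g x‖ₑ ^ 2) *
      ∑ k ∈ T, ENNReal.ofReal (w k) * ∫⁻ x, ‖f (translate x (P k))‖ₑ ^ 2 := by
  set m : 𝔼 → ℝ := fun η => ∑ k ∈ T, w k * ‖𝓕 (P k) η‖ ^ 2 with hmdef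
  have hm : ContDiff ℝ (⊤ : ℕ∞) m := by
    refine ContDiff.sum fun k _ => contDiff_const.mul ?_
    exact (contDiff_norm_sq ℝ).comp ((𝓕 (P k)).smooth ⊤)
  obtain ⟨u, hu⟩ := exists_schwartz_div hg hm fun η hη => (hc.trans_le (hT η hη)).ne'
  -- The canonical dual frame: since `𝓕 g = m u`, the functions with transforms `w k * conj (𝓕 (P
  -- k)) * u`, convolved with `P k`, add up to `g`.
  let v : ℕ → 𝓢(𝔼, ℂ) := fun k => ((w k : ℝ) : ℂ) • mulS (conjS (𝓕 (P k))) u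
  have hv : ∀ k, 𝓕 (𝓕⁻ (v k)) = v k := fun k =>
    FourierTransform.fourier_fourierInv_eq (E := 𝓢(𝔼, ℂ)) _
  have hvapp : ∀ k η, v k η = ((w k : ℝ) : ℂ) * (conj (𝓕 (P k) η) * u η) := fun k η => rfl
  have hdec : g = ∑ k ∈ T, conv (𝓕⁻ (v k)) (P k) := by
    apply schwartz_fourier_injective
    ext η
    rw [FourierTransform.fourier_sum, sum_apply]
    simp_rw [fourier_conv_apply, hv, hvapp]
    have h1 : ∀ k ∈ T, ((w k : ℝ) : ℂ) * (conj (𝓕 (P k) η) * u η) * 𝓕 (P k) η =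
        ((w k * ‖𝓕 (P k) η‖ ^ 2 : ℝ) : ℂ) * u η := by
      intro k _
      have h2 := Complex.mul_conj' (𝓕 (P k) η)
      push_cast
      rw [← h2]
      ring
    rw [Finset.sum_congr rfl h1, ← Finset.sum_mul, ← ofReal_sum, hu]
    change _ = ((m η : ℝ) : ℂ) * ((m η)⁻¹ • 𝓕 g η)
    by_cases hη : η ∈ tsupport (𝓕 g : 𝓢(𝔼, ℂ))
    · have hne : m η ≠ 0 := (hc.trans_le (hT η hη)).ne'
      rw [real_smul, ← mul_assoc, ← ofReal_mul, mul_inv_cancel₀ hne, ofReal_one, one_mul]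
    · rw [image_eq_zero_of_notMem_tsupport hη, smul_zero, mul_zero]
  have hF : ∀ k, Continuous fun x => f (translate x (P k)) := fun k =>
    continuous_apply_translate f (P k)
  set X : ℕ → ℝ≥0∞ := fun k => ∫⁻ x, ‖(𝓕⁻ (v k)) x‖ₑ ^ 2 with hX
  set Y : ℕ → ℝ≥0∞ := fun k => ∫⁻ x, ‖f (translate x (P k))‖ₑ ^ 2 with hY
  have hw0 : ∀ k, ENNReal.ofReal (w k) ≠ 0 := fun k => by simpa using hw k
  -- The weights are distributed so that, after Cauchy-Schwarz over `k`, the first factor sums to `∫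
  -- m |u|²`, which is at most `c⁻¹ ‖g‖²`.
  have hsplit : ∀ k, X k ^ (1 / 2 : ℝ) * Y k ^ (1 / 2 : ℝ) =
      ((ENNReal.ofReal (w k))⁻¹ * X k) ^ (1 / 2 : ℝ) *
        (ENNReal.ofReal (w k) * Y k) ^ (1 / 2 : ℝ) := by
    intro k
    rw [← ENNReal.mul_rpow_of_nonneg _ _ (by norm_num), ← ENNReal.mul_rpow_of_nonneg _ _
      (by norm_num)]
    congr 1
    rw [mul_mul_mul_comm, ENNReal.inv_mul_cancel (hw0 k) ENNReal.ofReal_ne_top, one_mul]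
  have h1 : ‖f g‖ₑ ≤ ∑ k ∈ T, X k ^ (1 / 2 : ℝ) * Y k ^ (1 / 2 : ℝ) := by
    conv_lhs => rw [hdec, map_sum]
    refine (enorm_sum_le _ _).trans (Finset.sum_le_sum fun k _ => ?_)
    rw [apply_conv]
    refine (enorm_integral_le_lintegral_enorm _).trans ?_
    simp_rw [enorm_mul]
    exact lintegral_mul_le_sqrt (𝓕⁻ (v k)).continuous.enorm.aemeasurable
      (hF k).enorm.aemeasurable
  have h2 : ‖f g‖ₑ ^ 2 ≤ (∑ k ∈ T, (ENNReal.ofReal (w k))⁻¹ * X k) *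
      ∑ k ∈ T, ENNReal.ofReal (w k) * Y k := by
    have h3 := ENNReal.inner_le_Lp_mul_Lq T
      (fun k => ((ENNReal.ofReal (w k))⁻¹ * X k) ^ (1 / 2 : ℝ))
      (fun k => (ENNReal.ofReal (w k) * Y k) ^ (1 / 2 : ℝ)) Real.HolderConjugate.two_two
    have h4 : ∀ z : ℝ≥0∞, (z ^ (1 / 2 : ℝ)) ^ (2 : ℝ) = z := fun z => by
      rw [← ENNReal.rpow_mul]; norm_num
    simp only [h4] at h3
    simp_rw [hsplit] at h1
    calc ‖f g‖ₑ ^ 2 ≤ _ := pow_le_pow_left₀ zero_le (h1.trans h3) 2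
      _ = _ := by
        rw [mul_pow, ← ENNReal.rpow_natCast, ← ENNReal.rpow_natCast]
        push_cast
        rw [h4, h4]
  refine h2.trans ?_
  gcongr
  have hXk : ∀ k, (ENNReal.ofReal (w k))⁻¹ * X k =
      ∫⁻ η, ENNReal.ofReal (w k * ‖𝓕 (P k) η‖ ^ 2) * ‖u η‖ₑ ^ 2 := by
    intro k
    rw [hX]
    simp only
    rw [← lintegral_fourier_sq, hv, ← lintegral_const_mul' _ _ (ENNReal.inv_ne_top.2 (hw0 k))]
    congr 1 with η
    rw [hvapp, enorm_mul, enorm_mul, ENNReal.ofReal_mul (hw k).le,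
      ENNReal.ofReal_pow (norm_nonneg _), ofReal_norm]
    have e1 : ‖((w k : ℝ) : ℂ)‖ₑ = ENNReal.ofReal (w k) := by
      rw [← ofReal_norm, norm_real, Real.norm_of_nonneg (hw k).le]
    have e2 : ‖conj (𝓕 (P k) η)‖ₑ = ‖𝓕 (P k) η‖ₑ := by
      rw [← ofReal_norm, ← ofReal_norm, RCLike.norm_conj]
    rw [e1, e2, mul_pow, mul_pow, ← mul_assoc, sq (ENNReal.ofReal (w k)),
      ← mul_assoc (ENNReal.ofReal (w k))⁻¹,
      ENNReal.inv_mul_cancel (hw0 k) ENNReal.ofReal_ne_top, one_mul, mul_assoc]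
  simp_rw [hXk]
  rw [← lintegral_finsetSum']
  · rw [← lintegral_fourier_sq, ← lintegral_const_mul' _ _
      (ENNReal.inv_ne_top.2 (by simpa using hc))]
    refine lintegral_mono fun η => ?_
    simp only
    rw [← Finset.sum_mul, ← ENNReal.ofReal_sum_of_nonneg
      fun k _ => mul_nonneg (hw k).le (by positivity)]
    change ENNReal.ofReal (m η) * ‖u η‖ₑ ^ 2 ≤ _
    by_cases hη : η ∈ tsupport (𝓕 g : 𝓢(𝔼, ℂ))
    · have hmc : c ≤ m η := hT η hη
      have hmpos : 0 < m η := hc.trans_le hmc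
      rw [hu, enorm_smul, mul_pow, ← mul_assoc]
      gcongr
      rw [← ofReal_norm, Real.norm_of_nonneg (by positivity), ← ENNReal.ofReal_pow (by positivity),
        ← ENNReal.ofReal_mul hmpos.le, ← ENNReal.ofReal_inv_of_pos hc]
      apply ENNReal.ofReal_le_ofReal
      rw [sq, ← mul_assoc, mul_inv_cancel₀ hmpos.ne', one_mul]
      exact inv_anti₀ hc hmc
    · rw [hu, image_eq_zero_of_notMem_tsupport hη, smul_zero]
      simp
  · intro k _
    have h5 : Continuous fun η => ENNReal.ofReal (w k * ‖𝓕 (P k) η‖ ^ 2) * ‖u η‖ₑ ^ 2 := by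
      have h6 : Continuous fun η => ENNReal.ofReal (w k * ‖𝓕 (P k) η‖ ^ 2) :=
        ENNReal.continuous_ofReal.comp
          (continuous_const.mul ((𝓕 (P k)).continuous.norm.pow 2))
      have h7 : ∀ η, ‖u η‖ₑ ^ 2 = ENNReal.ofReal (‖u η‖ ^ 2) := fun η => by
        rw [ENNReal.ofReal_pow (norm_nonneg _), ofReal_norm]
      simp_rw [h7, ← ENNReal.ofReal_mul (mul_nonneg (hw k).le (sq_nonneg _))]
      exact ENNReal.continuous_ofReal.comp
        ((continuous_const.mul ((𝓕 (P k)).continuous.norm.pow 2)).mul (u.continuous.norm.pow 2))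
    exact h5.aemeasurable

/-- Approximation by convolution with an `L¹`-normalized kernel, tested against a tempered
distribution. -/
theorem tendsto_apply_conv_dilateL1 (f : 𝓢'(𝔼, ℂ)) {K : 𝓢(𝔼, ℂ)} (hK : 𝓕 K 0 = 1)
    (g : 𝓢(𝔼, ℂ)) :
    Filter.Tendsto (fun n : ℕ => f (conv (dilateL1 ((n : ℝ) + 1) (by positivity) K) g))
      Filter.atTop (nhds (f g)) := by
  obtain ⟨C, N, hC, hb⟩ := exists_norm_apply_translate_le f g
  have hint : ∫ y, K y * f g = f g := by
    have h1 : 𝓕 K 0 = ∫ y, K y := by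
      rw [SchwartzMap.fourier_coe, Real.fourier_eq']
      simp
    rw [integral_mul_const, ← h1, hK, one_mul]
  have hform : ∀ n : ℕ, f (conv (dilateL1 ((n : ℝ) + 1) (by positivity) K) g) =
      ∫ y, K y * f (translate (((n : ℝ) + 1)⁻¹ • y) g) := by
    intro n
    have ha : 0 < (n : ℝ) + 1 := by positivity
    have h1 := Measure.integral_comp_smul (volume : Measure 𝔼)
      (fun y => K y * f (translate (((n : ℝ) + 1)⁻¹ • y) g)) ((n : ℝ) + 1)
    rw [abs_of_pos (by positivity), real_smul, ofReal_inv] at h1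
    have hne : (((((n : ℝ) + 1) ^ Module.finrank ℝ 𝔼 : ℝ)) : ℂ) ≠ 0 := by
      exact_mod_cast (pow_pos ha _).ne'
    rw [eq_inv_mul_iff_mul_eq₀ hne] at h1
    rw [apply_conv, ← h1, ← integral_const_mul]
    congr 1 with x
    rw [dilateL1_apply, smul_smul, inv_mul_cancel₀ ha.ne', one_smul, mul_assoc]
  simp_rw [hform]
  rw [← hint]
  refine tendsto_integral_of_dominated_convergence (fun y => C * ((1 + ‖y‖) ^ N * ‖K y‖))
    (fun n => ?_) ((integrable_one_add_norm_pow_mul K N).const_mul C) (fun n => ?_) ?_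
  · exact (K.continuous.mul ((continuous_apply_translate f g).comp
      (continuous_const_smul _))).aestronglyMeasurable
  · refine Filter.Eventually.of_forall fun y => ?_
    rw [norm_mul]
    have hy : ‖((n : ℝ) + 1)⁻¹ • y‖ ≤ ‖y‖ := by
      rw [norm_smul, norm_inv, Real.norm_of_nonneg (by positivity)]
      refine mul_le_of_le_one_left (norm_nonneg _) (inv_le_one_of_one_le₀ ?_)
      linarith [(Nat.cast_nonneg n : (0 : ℝ) ≤ n)]
    calc _ ≤ ‖K y‖ * (C * (1 + ‖((n : ℝ) + 1)⁻¹ • y‖) ^ N) := by gcongr; exact hb _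
      _ ≤ ‖K y‖ * (C * (1 + ‖y‖) ^ N) := by gcongr
      _ = _ := by ring
  · refine Filter.Eventually.of_forall fun y => ?_
    refine Filter.Tendsto.const_mul _ ?_
    have h1 : Filter.Tendsto (fun n : ℕ => ((n : ℝ) + 1)⁻¹ • y) Filter.atTop (nhds 0) := by
      have := tendsto_one_div_add_atTop_nhds_zero_nat (𝕜 := ℝ)
      simpa using this.smul_const y
    have h2 := ((continuous_apply_translate f g).tendsto 0).comp h1
    have h3 : translate (0 : 𝔼) g = g := by
      ext t
      simp
    rwa [h3] at h2

theorem enorm_toLp_sq (g : 𝓢(𝔼, ℂ)) : ‖g.toLp 2‖ₑ ^ 2 = ∫⁻ x, ‖g x‖ₑ ^ 2 := by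
  rw [Lp.enorm_def, eLpNorm_congr_ae (g.coeFn_toLp 2 volume),
    eLpNorm_eq_lintegral_rpow_enorm_toReal (by norm_num) (by norm_num)]
  rw [← ENNReal.rpow_natCast, ← ENNReal.rpow_mul]
  norm_num

theorem toLp_conv_le {K : 𝓢(𝔼, ℂ)} (hK : ∀ η, ‖𝓕 K η‖ ≤ 1) (g : 𝓢(𝔼, ℂ)) :
    ‖(conv K g).toLp 2‖ ≤ ‖g.toLp 2‖ := by
  have h : ‖(conv K g).toLp 2‖ₑ ^ 2 ≤ ‖g.toLp 2‖ₑ ^ 2 := by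
    rw [enorm_toLp_sq, enorm_toLp_sq, ← lintegral_fourier_sq (conv K g), ← lintegral_fourier_sq g]
    refine lintegral_mono fun η => ?_
    rw [fourier_conv_apply]
    refine pow_le_pow_left₀ zero_le ?_ 2
    rw [← ofReal_norm, ← ofReal_norm]
    apply ENNReal.ofReal_le_ofReal
    rw [norm_mul]
    exact mul_le_of_le_one_left (norm_nonneg _) (hK η)
  have h2 := (ENNReal.pow_le_pow_left_iff (two_ne_zero)).1 h
  rw [← ofReal_norm, ← ofReal_norm] at h2
  exact (ENNReal.ofReal_le_ofReal_iff (norm_nonneg _)).1 h2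

/-- A tempered distribution that is `L²`-bounded on functions with compact frequency support is
given by an `L²` function. -/
theorem exists_lp_of_bound (f : 𝓢'(𝔼, ℂ)) {C : ℝ} (hC : 0 ≤ C)
    (h : ∀ g : 𝓢(𝔼, ℂ), HasCompactSupport (𝓕 g : 𝓢(𝔼, ℂ)) → ‖f g‖ ≤ C * ‖g.toLp 2‖) :
    ∃ f₀ : Lp ℂ 2 (volume : Measure 𝔼), ‖f₀‖ ≤ C ∧ (f₀ : 𝓢'(𝔼, ℂ)) = f := by
  obtain ⟨K, hK1, hK2, hK3⟩ := exists_kernel (E := 𝔼) 1 one_pos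
  -- A general `g` is approximated by convolutions with band-limited kernels. These do not increase
  -- the `L²` norm, because the multiplier is bounded by `1`.
  have hall : ∀ g : 𝓢(𝔼, ℂ), ‖f g‖ ≤ C * ‖g.toLp 2‖ := by
    intro g
    have hlim := (tendsto_apply_conv_dilateL1 f (hK1 0 (by simp)) g).norm
    refine le_of_tendsto' hlim fun n => ?_
    have ha : 0 < (n : ℝ) + 1 := by positivity
    refine (h _ ?_).trans ?_
    · have h1 : ((𝓕 (conv (dilateL1 ((n : ℝ) + 1) ha K) g) : 𝓢(𝔼, ℂ)) : 𝔼 → ℂ) =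
          (fun η => (𝓕 K) (((n : ℝ) + 1)⁻¹ • η)) * fun η => 𝓕 g η := by
        funext η
        rw [fourier_conv_apply, fourier_dilateL1]
        rfl
      rw [h1]
      refine HasCompactSupport.mul_right ?_
      exact hK3.comp_homeomorph (Homeomorph.smulOfNeZero (((n : ℝ) + 1)⁻¹) (inv_ne_zero ha.ne'))
    · gcongr
      exact toLp_conv_le (fun η => by rw [fourier_dilateL1]; exact hK2 _) g
  obtain ⟨F, hF, hFe⟩ := exists_clm_comp_eq
    (SchwartzMap.toLpCLM ℂ ℂ 2 (volume : Measure 𝔼)).toLinearMap f.toLinearMap hC hall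
  set h₀ := (InnerProductSpace.toDual ℂ (Lp ℂ 2 (volume : Measure 𝔼))).symm F with hh₀
  -- The Riesz representative enters the inner product conjugated, while the pairing with `g` is
  -- bilinear; hence the `star`.
  refine ⟨star h₀, ?_, ?_⟩
  · have hstar : ‖star h₀‖ = ‖h₀‖ := by
      rw [Lp.norm_def, Lp.norm_def]
      congr 1
      refine eLpNorm_congr_norm_ae ?_
      filter_upwards [Lp.coeFn_star h₀] with x hx
      rw [hx, Pi.star_apply, norm_star]
    rw [hstar, hh₀, LinearIsometryEquiv.norm_map]
    exact hF
  · ext g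
    rw [Lp.toTemperedDistribution_apply]
    have h1 : F (g.toLp 2) = f g := hFe g
    rw [← h1, ← InnerProductSpace.toDual_symm_apply, ← hh₀, L2.inner_def]
    refine integral_congr_ae ?_
    filter_upwards [Lp.coeFn_star h₀, g.coeFn_toLp 2 volume] with x hx hgx
    rw [hx, hgx, Pi.star_apply, RCLike.inner_apply, smul_eq_mul]
    rfl

end Reconstruction

/-! ### Frame bounds for the packets -/

section Frame

variable {d : ℕ} {α ρ : ℝ}

local notation "𝔼" => EuclideanSpace ℝ (Fin d)

/-- The conjugated packet at the origin; a distribution is tested against its translates. -/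
def dualWindow (α : ℝ) (φ : 𝓢(𝔼, ℂ)) (ξ : 𝔼) (hξ : ξ ≠ 0) : 𝓢(𝔼, ℂ) :=
  conjS (packet α φ 0 ξ hξ)

/-- The phase is immaterial for moduli, so all coefficients at one frequency become samples of a
single function. -/
theorem conjS_packet (φ : 𝓢(𝔼, ℂ)) (x ξ : 𝔼) (hξ : ξ ≠ 0) :
    conjS (packet α φ x ξ hξ) =
      conj (cexp (((inner ℝ x ξ : ℝ) : ℂ) * I)) • translate x (dualWindow α φ ξ hξ) := by
  ext t
  change conj (packet α φ x ξ hξ t) = conj (cexp (((inner ℝ x ξ : ℝ) : ℂ) * I)) *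
    conj (packet α φ 0 ξ hξ (t - x))
  rw [packet_apply, packet_apply, ← map_mul, sub_zero, inner_sub_left, ofReal_sub, sub_mul,
    Complex.exp_sub]
  congr 1
  field_simp [Complex.exp_ne_zero]

theorem enorm_coeff (φ : 𝓢(𝔼, ℂ)) (Ω : Lattice d α ρ) (f : 𝓢'(𝔼, ℂ)) (k : ℕ) (j : Fin d → ℤ) :
    ‖coeff φ Ω f k j‖ₑ =
      ‖f (translate (Ω.pos k j) (dualWindow α φ (Ω.freq k) (Ω.freq_ne_zero k)))‖ₑ := by
  rw [coeff, conjS_packet, map_smul, smul_eq_mul, enorm_mul]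
  have h : ‖conj (cexp (((inner ℝ (Ω.pos k j) (Ω.freq k) : ℝ) : ℂ) * I))‖ₑ = 1 := by
    rw [← ofReal_norm, RCLike.norm_conj, norm_exp_ofReal_mul_I, ENNReal.ofReal_one]
  rw [h, one_mul]

theorem modNorm_sq (φ : 𝓢(𝔼, ℂ)) (Ω : Lattice d α ρ) (f : 𝓢'(𝔼, ℂ)) :
    modNorm φ Ω 2 2 0 f ^ 2 = ∑' k, ∑' j, ‖f (translate (Ω.pos k j)
      (dualWindow α φ (Ω.freq k) (Ω.freq_ne_zero k)))‖ₑ ^ 2 := by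
  have h : ∀ {ι : Type} (c : ι → ℝ≥0∞), ellNorm 2 c ^ 2 = ∑' i, c i ^ 2 := by
    intro ι c
    rw [ellNorm, if_neg (by norm_num), ← ENNReal.rpow_natCast, ← ENNReal.rpow_mul]
    norm_num
  rw [modNorm, h]
  congr 1 with k
  rw [Real.rpow_zero, ENNReal.ofReal_one, mul_one, h]
  simp_rw [enorm_coeff]

theorem rpow_norm_pos {ξ : 𝔼} (hξ : ξ ≠ 0) (s : ℝ) : 0 < ‖ξ‖ ^ s :=
  Real.rpow_pos_of_pos (norm_pos_iff.2 hξ) _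

/-- The squared amplitude is `a^d` and the squared dilation Jacobian is `a^(-2d)`, so the weight
`a^d` removes all powers of `a`. Conjugating the window flips the sign of `η`. -/
theorem norm_fourier_dualWindow (φ : 𝓢(𝔼, ℂ)) (ξ : 𝔼) (hξ : ξ ≠ 0) (η : 𝔼) :
    (‖ξ‖ ^ (1 - α)) ^ d * ‖𝓕 (dualWindow α φ ξ hξ) η‖ ^ 2 =
      ‖𝓕 φ ((‖ξ‖ ^ (1 - α))⁻¹ • (-η - (2 * Real.pi)⁻¹ • ξ))‖ ^ 2 := by
  have ha := rpow_norm_pos hξ (1 - α)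
  set a := ‖ξ‖ ^ (1 - α) with hadef
  set r := ‖ξ‖ ^ ((d : ℝ) / 2 * (1 - α)) with hr
  have hr2 : r ^ 2 = a ^ d := by
    rw [hr, hadef, ← Real.rpow_natCast, ← Real.rpow_mul (norm_nonneg _), ← Real.rpow_natCast,
      ← Real.rpow_mul (norm_nonneg _)]
    congr 1
    push_cast
    ring
  have hpk : packet α φ 0 ξ hξ = (r : ℂ) • modulate ξ (dilate a ha φ) := by
    ext t
    rw [packet_apply, smul_apply, modulate_apply, dilate_apply, sub_zero, smul_eq_mul]
    ring
  have h1 : 𝓕 (dualWindow α φ ξ hξ) η = conj (𝓕 (packet α φ 0 ξ hξ) (-η)) := by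
    rw [SchwartzMap.fourier_coe, SchwartzMap.fourier_coe, ← fourier_conj]
    rfl
  rw [h1, RCLike.norm_conj, hpk, FourierTransform.fourier_smul, smul_apply, fourier_modulate,
    fourier_dilate, norm_smul, norm_mul, norm_real, norm_real, mul_pow, mul_pow, Real.norm_eq_abs,
    sq_abs, Real.norm_eq_abs, sq_abs, hr2, finrank_euclideanSpace_fin, ← mul_assoc, ← mul_assoc]
  have : a ^ d * a ^ d * ((a ^ d)⁻¹) ^ 2 = 1 := by
    field_simp
  rw [this, one_mul]

theorem fourier_dualWindow_support {φ : 𝓢(𝔼, ℂ)} {R : ℝ} (hR : ∀ ζ, 𝓕 φ ζ ≠ 0 → ‖ζ‖ ≤ R)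
    (ξ : 𝔼) (hξ : ξ ≠ 0) (η : 𝔼) (h : 𝓕 (dualWindow α φ ξ hξ) η ≠ 0) :
    ‖η - -((2 * Real.pi)⁻¹ • ξ)‖ ≤ ‖ξ‖ ^ (1 - α) * R := by
  have ha := rpow_norm_pos hξ (1 - α)
  have h1 := norm_fourier_dualWindow (α := α) φ ξ hξ η
  have h2 := hR ((‖ξ‖ ^ (1 - α))⁻¹ • (-η - (2 * Real.pi)⁻¹ • ξ)) fun h0 => by
    rw [h0, norm_zero] at h1
    have : 0 < ‖𝓕 (dualWindow α φ ξ hξ) η‖ := norm_pos_iff.2 h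
    have : 0 < (‖ξ‖ ^ (1 - α)) ^ d * ‖𝓕 (dualWindow α φ ξ hξ) η‖ ^ 2 := by positivity
    rw [h1] at this
    norm_num at this
  rw [norm_smul, norm_inv, Real.norm_of_nonneg ha.le, inv_mul_le_iff₀ ha] at h2
  rwa [show η - -((2 * Real.pi)⁻¹ • ξ) = -(-η - (2 * Real.pi)⁻¹ • ξ) by abel, norm_neg]

theorem volume_closedBall_mul_pow {r : ℝ} (hr : 0 ≤ r) (a : ℝ) :
    volume (Metric.closedBall (0 : 𝔼) r) * ENNReal.ofReal (a ^ d) =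
      ENNReal.ofReal ((r * a) ^ d) * volume (Metric.closedBall (0 : 𝔼) 1) := by
  rw [Measure.addHaar_closedBall' volume (0 : 𝔼) hr, finrank_euclideanSpace_fin, mul_pow,
    ENNReal.ofReal_mul (by positivity)]
  ring

/-- Plancherel, since testing against translates is convolution with the reflected window. -/
theorem ofReal_mul_lintegral_eq (f : 𝓢(𝔼, ℂ)) (φ : 𝓢(𝔼, ℂ)) (ξ : 𝔼) (hξ : ξ ≠ 0) :
    ENNReal.ofReal ((‖ξ‖ ^ (1 - α)) ^ d) *
      ∫⁻ y, ‖(f : 𝓢'(𝔼, ℂ)) (translate y (dualWindow α φ ξ hξ))‖ₑ ^ 2 =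
    ∫⁻ η, ‖𝓕 f η‖ₑ ^ 2 * ‖𝓕 φ ((‖ξ‖ ^ (1 - α))⁻¹ • (η - (2 * Real.pi)⁻¹ • ξ))‖ₑ ^ 2 := by
  have ha := rpow_norm_pos hξ (1 - α)
  have h1 : ∀ y, (f : 𝓢'(𝔼, ℂ)) (translate y (dualWindow α φ ξ hξ)) =
      conv f (reflect 0 (dualWindow α φ ξ hξ)) y := by
    intro y
    rw [conv_apply]
    refine (SchwartzMap.toTemperedDistributionCLM_apply_apply volume f _).trans ?_
    congr 1 with t
    rw [reflect_apply, SchwartzMap.compSubConstCLM_apply, smul_eq_mul, mul_comm]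
    congr 2
    abel
  simp_rw [h1]
  rw [← lintegral_fourier_sq, ← lintegral_const_mul' _ _ ENNReal.ofReal_ne_top]
  congr 1 with η
  rw [fourier_conv_apply, enorm_mul, mul_pow, mul_left_comm]
  congr 1
  have h2 := norm_fourier_dualWindow (α := α) φ ξ hξ (-η)
  rw [neg_neg] at h2
  rw [← ofReal_norm, ← ofReal_norm, ← ENNReal.ofReal_pow (norm_nonneg _),
    ← ENNReal.ofReal_pow (norm_nonneg _), ← h2, norm_fourier_reflect,
    ENNReal.ofReal_mul (by positivity)]

theorem closedBall_one_pos_lt_top : 0 < volume (Metric.closedBall (0 : 𝔼) 1) ∧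
    volume (Metric.closedBall (0 : 𝔼) 1) < ∞ :=
  ⟨Metric.measure_closedBall_pos _ _ one_pos, measure_closedBall_lt_top⟩

/-- The sampled sum at one frequency is controlled by a frequency-localized energy. -/
theorem exists_tsum_sample_le {φ : 𝓢(𝔼, ℂ)} {R : ℝ} (hR : 0 < R)
    (hφ : ∀ ζ, 𝓕 φ ζ ≠ 0 → ‖ζ‖ ≤ R) (hρ : 0 < ρ) (Ω : Lattice d α ρ) :
    ∃ b : ℕ → ℝ≥0∞, (∀ k, b k < ∞) ∧ (∀ k l, 1 ≤ ‖Ω.freq k‖ → 1 ≤ ‖Ω.freq l‖ → b k = b l) ∧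
      ∀ (f : 𝓢(𝔼, ℂ)) (k : ℕ),
        ∑' j, ‖(f : 𝓢'(𝔼, ℂ)) (translate (Ω.pos k j)
          (dualWindow α φ (Ω.freq k) (Ω.freq_ne_zero k)))‖ₑ ^ 2 ≤
        b k * ∫⁻ η, ‖𝓕 f η‖ₑ ^ 2 * ‖𝓕 φ ((‖Ω.freq k‖ ^ (1 - α))⁻¹ •
          (η - (2 * Real.pi)⁻¹ • Ω.freq k))‖ₑ ^ 2 := by
  obtain ⟨C, hC, hS⟩ := exists_sampling (E := 𝔼) R hR
  obtain ⟨N, hN⟩ := Ω.pos_overlap hρ.le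
  obtain ⟨hV0, hVt⟩ := closedBall_one_pos_lt_top (d := d)
  let a : ℕ → ℝ := fun k => ‖Ω.freq k‖ ^ (1 - α)
  have ha : ∀ k, 0 < a k := fun k => rpow_norm_pos (Ω.freq_ne_zero k) _
  have hs : ∀ k, 0 < scale α (Ω.freq k) := fun k => scale_pos _
  let L : ℕ → ℝ := fun k => a k * (ρ * (scale α (Ω.freq k))⁻¹)
  have hL : ∀ k, 0 < L k := fun k => mul_pos (ha k) (mul_pos hρ (inv_pos.2 (hs k)))
  have hLa : ∀ k, L k / a k = ρ * (scale α (Ω.freq k))⁻¹ := fun k => by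
    simp only [L]
    rw [mul_div_cancel_left₀ _ (ha k).ne']
  let V : ℕ → ℝ≥0∞ := fun k =>
    ENNReal.ofReal (L k ^ d) * volume (Metric.closedBall (0 : 𝔼) 1)
  have hV : ∀ k, volume (Metric.closedBall (0 : 𝔼) (L k / a k)) * ENNReal.ofReal (a k ^ d) =
      V k := fun k => by
    rw [volume_closedBall_mul_pow (div_pos (hL k) (ha k)).le, div_mul_cancel₀ _ (ha k).ne']
  have hVk0 : ∀ k, V k ≠ 0 := fun k =>
    mul_ne_zero (by simpa using pow_pos (hL k) d) hV0.ne'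
  have hVkt : ∀ k, V k ≠ ∞ := fun k => ENNReal.mul_ne_top ENNReal.ofReal_ne_top hVt.ne
  let M : ℕ → ℝ≥0∞ := fun k =>
    N * (2 + 2 * ENNReal.ofReal (C * L k * (1 + L k) ^ (Module.finrank ℝ 𝔼 + 1)) ^ 2)
  have hM : ∀ k, M k < ∞ := fun k => by
    refine ENNReal.mul_lt_top (ENNReal.natCast_lt_top N) (ENNReal.add_lt_top.2 ⟨by norm_num, ?_⟩)
    exact ENNReal.mul_lt_top (by norm_num) (ENNReal.pow_lt_top ENNReal.ofReal_lt_top)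
  refine ⟨fun k => (V k)⁻¹ * M k, fun k => ENNReal.mul_lt_top
    (ENNReal.inv_lt_top.2 (pos_iff_ne_zero.2 (hVk0 k))) (hM k), fun k l hk hl => ?_, fun f k => ?_⟩
  -- For `|ξ| ≥ 1` the dilation factor equals the scale, so the normalized mesh is exactly `ρ` and
  -- the constant is the same for all such `k`.
  · have h1 : ∀ k, 1 ≤ ‖Ω.freq k‖ → L k = ρ := fun k hk => by
      have : scale α (Ω.freq k) = a k := by rw [scale, max_eq_right hk]
      simp only [L]
      rw [this, mul_left_comm, mul_inv_cancel₀ (ha k).ne', mul_one]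
    simp only [V, M]
    rw [h1 k hk, h1 l hl]
  · have h1 := (hS (a k) (ha k) (L k) (hL k).le _ _ (fourier_dualWindow_support (α := α) hφ
      (Ω.freq k) (Ω.freq_ne_zero k)) (f : 𝓢'(𝔼, ℂ))).1 (Ω.pos k) N (by rw [hLa]; exact hN k)
    have h2 := ofReal_mul_lintegral_eq (α := α) f φ (Ω.freq k) (Ω.freq_ne_zero k)
    rw [← h2]
    change _ ≤ (V k)⁻¹ * M k * (ENNReal.ofReal (a k ^ d) * _)
    rw [mul_assoc, ← ENNReal.mul_le_iff_le_inv (hVk0 k) (hVkt k), ← hV k]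
    calc _ = ENNReal.ofReal (a k ^ d) * (volume (Metric.closedBall (0 : 𝔼) (L k / a k)) *
          ∑' j, ‖(f : 𝓢'(𝔼, ℂ)) (translate (Ω.pos k j)
          (dualWindow α φ (Ω.freq k) (Ω.freq_ne_zero k)))‖ₑ ^ 2) := by ring
      _ ≤ _ := mul_le_mul' le_rfl h1
      _ = _ := by simp only [M]; ring

/-- Only the `k` with `2π η` in the enlarged ball about `ξ k` contribute, each at most `M ^ 2`. -/
theorem sum_frequency_window_le {φ : 𝓢(𝔼, ℂ)} {R : ℝ} (hφ : ∀ ζ, 𝓕 φ ζ ≠ 0 → ‖ζ‖ ≤ R)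
    {M N : ℝ} (hM : ∀ ζ, ‖𝓕 φ ζ‖ ≤ M) (ξ : ℕ → 𝔼) (hξ : ∀ k, ξ k ≠ 0) (T : Finset ℕ)
    (hN : ∀ (η : 𝔼) (T' : Finset ℕ), T' ⊆ T →
      (∀ k ∈ T', ‖η - ξ k‖ ≤ 2 * Real.pi * R * ‖ξ k‖ ^ (1 - α)) → (T'.card : ℝ) ≤ N) (η : 𝔼) :
    ∑ k ∈ T, ‖𝓕 φ ((‖ξ k‖ ^ (1 - α))⁻¹ • (η - (2 * Real.pi)⁻¹ • ξ k))‖ₑ ^ 2 ≤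
      ENNReal.ofReal (N * M ^ 2) := by
  classical
  set u : ℕ → 𝔼 := fun k => (‖ξ k‖ ^ (1 - α))⁻¹ • (η - (2 * Real.pi)⁻¹ • ξ k) with hu
  have hM0 : 0 ≤ M := (norm_nonneg _).trans (hM 0)
  have h1 : ∑ k ∈ T, ‖𝓕 φ (u k)‖ₑ ^ 2 = ENNReal.ofReal (∑ k ∈ T, ‖𝓕 φ (u k)‖ ^ 2) := by
    rw [ENNReal.ofReal_sum_of_nonneg fun k _ => by positivity]
    refine Finset.sum_congr rfl fun k _ => ?_
    rw [ENNReal.ofReal_pow (norm_nonneg _), ofReal_norm]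
  change ∑ k ∈ T, ‖𝓕 φ (u k)‖ₑ ^ 2 ≤ _
  rw [h1]
  apply ENNReal.ofReal_le_ofReal
  rw [← Finset.sum_filter_of_ne (p := fun k => 𝓕 φ (u k) ≠ 0)
    fun k _ h h0 => h (by rw [h0]; simp)]
  have h2 := hN ((2 * Real.pi) • η) (T.filter fun k => 𝓕 φ (u k) ≠ 0) (Finset.filter_subset _ _)
    fun k hk => by
      have ha := rpow_norm_pos (hξ k) (1 - α)
      have h3 := hφ _ (Finset.mem_filter.1 hk).2
      rw [hu, norm_smul, norm_inv, Real.norm_of_nonneg ha.le, inv_mul_le_iff₀ ha] at h3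
      have h4 : (2 * Real.pi) • η - ξ k = (2 * Real.pi) • (η - (2 * Real.pi)⁻¹ • ξ k) := by
        rw [smul_sub, smul_smul, mul_inv_cancel₀ (by positivity), one_smul]
      rw [h4, norm_smul, Real.norm_of_nonneg (by positivity)]
      calc _ ≤ 2 * Real.pi * (‖ξ k‖ ^ (1 - α) * R) := by gcongr
        _ = _ := by ring
  refine (Finset.sum_le_card_nsmul _ _ (M ^ 2) fun k _ => ?_).trans ?_
  · exact pow_le_pow_left₀ (norm_nonneg _) (hM _) 2
  · rw [nsmul_eq_mul]
    gcongr

/-- Low frequencies are finite in number, so no uniformity is needed there. High frequencies share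
one sampling constant and have bounded overlap. -/
theorem exists_modNorm_schwartz_le {φ : 𝓢(𝔼, ℂ)} {R : ℝ} (hR : 0 < R)
    (hφ : ∀ ζ, 𝓕 φ ζ ≠ 0 → ‖ζ‖ ≤ R) (hα : 0 < α) (hρ : 0 < ρ) (Ω : Lattice d α ρ) :
    ∃ B : ℝ≥0∞, B < ∞ ∧ ∀ f : 𝓢(𝔼, ℂ),
      modNorm φ Ω 2 2 0 (f : 𝓢'(𝔼, ℂ)) ^ 2 ≤ B * ‖f.toLp 2‖ₑ ^ 2 := by
  classical
  obtain ⟨b, hb, hbc, hle⟩ := exists_tsum_sample_le hR hφ hρ Ω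
  obtain ⟨K, hK, N, hN0, hN⟩ := Ω.exists_high_overlap hα hρ (R := 2 * Real.pi * R) (by positivity)
  have hlow := Ω.finite_low hρ K
  obtain ⟨M, hM⟩ : ∃ M : ℝ, ∀ ζ, ‖𝓕 φ ζ‖ ≤ M :=
    ⟨_, fun ζ => SchwartzMap.norm_le_seminorm ℝ (𝓕 φ) ζ⟩
  obtain ⟨b', hb't, hb'⟩ : ∃ b' : ℝ≥0∞, b' < ∞ ∧ ∀ k, K ≤ ‖Ω.freq k‖ → b k ≤ b' := by
    by_cases h : ∃ k, K ≤ ‖Ω.freq k‖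
    · obtain ⟨l, hl⟩ := h
      exact ⟨b l, hb l, fun k hk => (hbc k l (hK.trans hk) (hK.trans hl)).le⟩
    · exact ⟨0, by simp, fun k hk => (h ⟨k, hk⟩).elim⟩
  let J : 𝓢(𝔼, ℂ) → ℕ → 𝔼 → ℝ≥0∞ := fun f k η => ‖𝓕 f η‖ₑ ^ 2 *
    ‖𝓕 φ ((‖Ω.freq k‖ ^ (1 - α))⁻¹ • (η - (2 * Real.pi)⁻¹ • Ω.freq k))‖ₑ ^ 2
  have hJm : ∀ f k, Measurable (J f k) := fun f k => by
    refine ((𝓕 f).continuous.enorm.measurable.pow_const 2).mul (Measurable.pow_const ?_ 2)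
    have h : Continuous fun η : 𝔼 =>
        𝓕 φ ((‖Ω.freq k‖ ^ (1 - α))⁻¹ • (η - (2 * Real.pi)⁻¹ • Ω.freq k)) :=
      (𝓕 φ).continuous.comp (by fun_prop)
    exact h.enorm.measurable
  have hf : ∀ f : 𝓢(𝔼, ℂ), ∫⁻ η, ‖𝓕 f η‖ₑ ^ 2 = ‖f.toLp 2‖ₑ ^ 2 := fun f => by
    rw [lintegral_fourier_sq, enorm_toLp_sq]
  have hsum : ∀ (f : 𝓢(𝔼, ℂ)) (T : Finset ℕ) (N' : ℝ),
      (∀ (η : 𝔼) (T' : Finset ℕ), T' ⊆ T → (∀ k ∈ T', ‖η - Ω.freq k‖ ≤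
        2 * Real.pi * R * ‖Ω.freq k‖ ^ (1 - α)) → (T'.card : ℝ) ≤ N') →
      ∑ k ∈ T, ∫⁻ η, J f k η ≤ ENNReal.ofReal (N' * M ^ 2) * ‖f.toLp 2‖ₑ ^ 2 := by
    intro f T N' hT
    rw [← lintegral_finsetSum _ fun k _ => hJm f k, ← hf,
      ← lintegral_const_mul' _ _ ENNReal.ofReal_ne_top]
    refine lintegral_mono fun η => ?_
    simp only [J]
    rw [← Finset.mul_sum, mul_comm]
    gcongr
    exact sum_frequency_window_le hφ hM Ω.freq Ω.freq_ne_zero T hT η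
  refine ⟨(∑ k ∈ hlow.toFinset, b k) * ENNReal.ofReal (hlow.toFinset.card * M ^ 2) +
    b' * ENNReal.ofReal (N * M ^ 2), ?_, fun f => ?_⟩
  · exact ENNReal.add_lt_top.2 ⟨ENNReal.mul_lt_top (ENNReal.sum_lt_top.2 fun k _ => hb k)
      ENNReal.ofReal_lt_top, ENNReal.mul_lt_top hb't ENNReal.ofReal_lt_top⟩
  rw [modNorm_sq, ENNReal.tsum_eq_iSup_sum]
  refine iSup_le fun T => ?_
  refine (Finset.sum_le_sum fun k _ => hle f k).trans ?_
  change ∑ k ∈ T, b k * ∫⁻ η, J f k η ≤ _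
  rw [← Finset.sum_filter_add_sum_filter_not T fun k => ‖Ω.freq k‖ < K, add_mul]
  refine add_le_add ?_ ?_
  · have h1 : ∑ k ∈ T with ‖Ω.freq k‖ < K, b k * ∫⁻ η, J f k η ≤
        ∑ k ∈ hlow.toFinset, b k * ∫⁻ η, J f k η := by
      refine Finset.sum_le_sum_of_subset fun k hk => ?_
      rw [Set.Finite.mem_toFinset]
      exact (Finset.mem_filter.1 hk).2
    refine h1.trans ?_
    rw [Finset.sum_mul, Finset.sum_mul]
    refine Finset.sum_le_sum fun k hk => ?_
    rw [mul_assoc]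
    gcongr
    refine le_trans ?_ (hsum f hlow.toFinset hlow.toFinset.card fun η T' hT' _ => by
      exact_mod_cast Finset.card_le_card hT')
    exact Finset.single_le_sum (f := fun k => ∫⁻ η, J f k η) (fun _ _ => zero_le) hk
  · have h1 : ∑ k ∈ T with ¬ ‖Ω.freq k‖ < K, b k * ∫⁻ η, J f k η ≤
        ∑ k ∈ T with ¬ ‖Ω.freq k‖ < K, b' * ∫⁻ η, J f k η := by
      refine Finset.sum_le_sum fun k hk => ?_
      gcongr
      exact hb' k (not_lt.1 (Finset.mem_filter.1 hk).2)
    refine h1.trans ?_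
    rw [← Finset.mul_sum, mul_assoc]
    gcongr
    refine hsum f _ N fun η T' hT' h => hN η T' fun k hk => ⟨?_, h k hk⟩
    exact not_lt.1 (Finset.mem_filter.1 (hT' hk)).2

/-- Each finite partial sum is continuous on `L²`, so the Schwartz bound extends by density before
the supremum is taken. -/
theorem exists_modNorm_le {φ : 𝓢(𝔼, ℂ)} {R : ℝ} (hR : 0 < R)
    (hφ : ∀ ζ, 𝓕 φ ζ ≠ 0 → ‖ζ‖ ≤ R) (hα : 0 < α) (hρ : 0 < ρ) (Ω : Lattice d α ρ) :
    ∃ B : ℝ≥0∞, B < ∞ ∧ ∀ f : Lp ℂ 2 (volume : Measure 𝔼),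
      modNorm φ Ω 2 2 0 (f : 𝓢'(𝔼, ℂ)) ^ 2 ≤ B * ‖f‖ₑ ^ 2 := by
  obtain ⟨B, hB, h⟩ := exists_modNorm_schwartz_le hR hφ hα hρ Ω
  refine ⟨B, hB, fun f => ?_⟩
  let Q : ℕ × (Fin d → ℤ) → 𝓢(𝔼, ℂ) := fun p => translate (Ω.pos p.1 p.2)
    (dualWindow α φ (Ω.freq p.1) (Ω.freq_ne_zero p.1))
  have hsq : ∀ F : 𝓢'(𝔼, ℂ), modNorm φ Ω 2 2 0 F ^ 2 = ∑' p, ‖F (Q p)‖ₑ ^ 2 := fun F => by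
    rw [modNorm_sq]
    exact (ENNReal.tsum_prod (f := fun k j => ‖F (Q (k, j))‖ₑ ^ 2)).symm
  simp_rw [hsq] at h ⊢
  rw [ENNReal.tsum_eq_iSup_sum]
  refine iSup_le fun T => ?_
  have hcont : ∀ P : 𝓢(𝔼, ℂ), Continuous fun f : Lp ℂ 2 (volume : Measure 𝔼) =>
      (f : 𝓢'(𝔼, ℂ)) P := fun P =>
    (continuous_eval_const P).comp
      (Lp.toTemperedDistributionCLM ℂ (volume : Measure 𝔼) 2).continuous
  have hpow : Continuous fun z : ℝ≥0∞ => z ^ 2 := ENNReal.continuous_pow 2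
  refine DenseRange.induction_on (p := fun f : Lp ℂ 2 (volume : Measure 𝔼) =>
      ∑ p ∈ T, ‖(f : 𝓢'(𝔼, ℂ)) (Q p)‖ₑ ^ 2 ≤ B * ‖f‖ₑ ^ 2)
    (SchwartzMap.denseRange_toLpCLM (F := ℂ) (p := 2) (μ := (volume : Measure 𝔼)) (by norm_num))
    f ?_ fun g => ?_
  · refine isClosed_le ?_ ?_
    · exact continuous_finsetSum _ fun p _ => hpow.comp (hcont (Q p)).enorm
    · exact (ENNReal.continuous_const_mul hB.ne).comp (hpow.comp continuous_enorm)
  · refine (ENNReal.sum_le_tsum T).trans ?_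
    have h1 := h g
    rw [← Lp.toTemperedDistribution_toLp_eq (p := 2)] at h1
    exact h1

/-- Packets are dilated by `|ξ|^(1-α)` even where the lattice scale is frozen at `1`. Away from the
origin the normalized mesh stays of order `ρ`. -/
theorem rpow_norm_le_scale {c : ℝ} (hc : 0 < c) (hc1 : c ≤ 1) {ξ : 𝔼} (hξ : c ≤ ‖ξ‖) :
    ‖ξ‖ ^ (1 - α) ≤ c⁻¹ ^ |1 - α| * scale α ξ := by
  have hc' : 1 ≤ c⁻¹ := (one_le_inv₀ hc).2 hc1
  rcases le_total ‖ξ‖ 1 with h | h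
  · rw [scale, max_eq_left h, Real.one_rpow, mul_one]
    exact (rpow_mem_Icc_of_mem_Icc hc' (by rwa [inv_inv]) (h.trans hc') _).2
  · rw [scale, max_eq_right h]
    exact le_mul_of_one_le_left (Real.rpow_nonneg (norm_nonneg _) _)
      (Real.one_le_rpow hc' (abs_nonneg _))

theorem Lattice.exists_finset_cover (Ω : Lattice d α ρ) (φ : 𝓢(𝔼, ℂ)) {c₁ c : ℝ} (hc : 0 < c)
    (hcov : ∀ η : 𝔼, ∃ k, c₁ ≤ ‖Ω.freq k‖ ∧
      c ≤ ‖𝓕 φ ((‖Ω.freq k‖ ^ (1 - α))⁻¹ • (η - (2 * Real.pi)⁻¹ • Ω.freq k))‖)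
    {S : Set 𝔼} (hS : IsCompact S) :
    ∃ T : Finset ℕ, (∀ k ∈ T, c₁ ≤ ‖Ω.freq k‖) ∧ ∀ η ∈ S,
      (c / 2) ^ 2 ≤ ∑ k ∈ T, (‖Ω.freq k‖ ^ (1 - α)) ^ d *
        ‖𝓕 (dualWindow α φ (Ω.freq k) (Ω.freq_ne_zero k)) η‖ ^ 2 := by
  classical
  let m : ℕ → 𝔼 → ℝ := fun k η => (‖Ω.freq k‖ ^ (1 - α)) ^ d *
    ‖𝓕 (dualWindow α φ (Ω.freq k) (Ω.freq_ne_zero k)) η‖ ^ 2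
  have hm0 : ∀ k η, 0 ≤ m k η := fun k η =>
    mul_nonneg (pow_nonneg (rpow_norm_pos (Ω.freq_ne_zero k) _).le _) (sq_nonneg _)
  have hmc : ∀ k, Continuous (m k) := fun k =>
    continuous_const.mul ((SchwartzMap.continuous _).norm.pow 2)
  -- Lowering `c` to `c / 2` allows a strict inequality, hence open sets.
  obtain ⟨T, hT⟩ := hS.elim_finite_subcover
    (fun k : ℕ => {η | c₁ ≤ ‖Ω.freq k‖ ∧ (c / 2) ^ 2 < m k η}) (fun k => by
      by_cases h : c₁ ≤ ‖Ω.freq k‖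
      · simp only [h, true_and]
        exact isOpen_lt continuous_const (hmc k)
      · simp [h]) (fun η _ => by
      obtain ⟨k, hk, hk'⟩ := hcov (-η)
      refine Set.mem_iUnion.2 ⟨k, hk, ?_⟩
      simp only [m]
      rw [norm_fourier_dualWindow]
      have : c ^ 2 ≤ ‖𝓕 φ ((‖Ω.freq k‖ ^ (1 - α))⁻¹ • (-η - (2 * Real.pi)⁻¹ • Ω.freq k))‖ ^ 2 :=
        pow_le_pow_left₀ hc.le hk' 2
      nlinarith)
  refine ⟨T.filter fun k => c₁ ≤ ‖Ω.freq k‖, fun k hk => (Finset.mem_filter.1 hk).2,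
    fun η hη => ?_⟩
  obtain ⟨k, hk, hkT, hk'⟩ : ∃ k, c₁ ≤ ‖Ω.freq k‖ ∧ k ∈ T ∧ (c / 2) ^ 2 < m k η := by
    simpa using hT hη
  exact hk'.le.trans (Finset.single_le_sum (f := fun k => m k η) (fun k _ => hm0 k η)
    (Finset.mem_filter.2 ⟨hkT, hk⟩))

/-- A uniform lower frame bound for all sufficiently fine lattices, together with the
identification of distributions of finite norm as `L²` functions. -/
theorem exists_le_modNorm {φ : 𝓢(𝔼, ℂ)} {R : ℝ} (hR : 0 < R)
    (hφ : ∀ ζ, 𝓕 φ ζ ≠ 0 → ‖ζ‖ ≤ R) (hα : 0 < α) {ζ₀ : 𝔼} (hζ₀ : ζ₀ ≠ 0) (hφζ : 𝓕 φ ζ₀ ≠ 0) :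
    ∃ ρ₀ : ℝ, 0 < ρ₀ ∧ ∃ D : ℝ, 0 < D ∧ ∀ ρ : ℝ, 0 < ρ → ρ ≤ ρ₀ → ∀ Ω : Lattice d α ρ,
      ∀ f : 𝓢'(𝔼, ℂ), modNorm φ Ω 2 2 0 f < ∞ →
        ∃ f₀ : Lp ℂ 2 (volume : Measure 𝔼), (f₀ : 𝓢'(𝔼, ℂ)) = f ∧
          ‖f₀‖ ^ 2 ≤ D * (modNorm φ Ω 2 2 0 f ^ 2).toReal := by
  obtain ⟨C, hC, hS⟩ := exists_sampling (E := 𝔼) R hR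
  have hpi : (0 : ℝ) < 2 * Real.pi := by positivity
  obtain ⟨ρ₁, c₁, c, hρ₁, hc₁, hc₁1, hc, hcov⟩ := exists_frequency_cover hα
    -- The rescaling passes from the frequencies of `𝓕` to those in which the lattice is given.
    (Z := fun ζ : 𝔼 => 𝓕 φ ((2 * Real.pi)⁻¹ • ζ))
    ((𝓕 φ).continuous.comp (continuous_const_smul _)) (ζ₀ := (2 * Real.pi) • ζ₀)
    (smul_ne_zero hpi.ne' hζ₀) (by rwa [smul_smul, inv_mul_cancel₀ hpi.ne', one_smul])
  obtain ⟨hV0, hVt⟩ := closedBall_one_pos_lt_top (d := d)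
  set q := c₁⁻¹ ^ |1 - α| with hq
  have hq0 : 0 < q := Real.rpow_pos_of_pos (inv_pos.2 hc₁) _
  set e := Module.finrank ℝ 𝔼 + 1 with he
  -- For `L ≤ L₀` one has `1 + L ≤ 2` and `C L (1 + L)^e ≤ 1 / 2`, the absorption threshold.
  set L₀ : ℝ := min 1 (1 / (2 * (C + 1) * 2 ^ e)) with hL₀
  have hL₀pos : 0 < L₀ := by positivity
  set V := volume (Metric.closedBall (0 : 𝔼) 1) with hV
  have hVr : 0 < V.toReal := ENNReal.toReal_pos hV0.ne' hVt.ne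
  -- In the constant, `4 V` comes from sampling, with `L^d ≤ 1`, and `(c / 2) ^ 2` from the finite
  -- frequency cover. The compact support of `𝓕 g` affects only the finite set `T`, not the
  -- constant.
  refine ⟨min ρ₁ (L₀ / q), by positivity, 4 * V.toReal / (c / 2) ^ 2, by positivity, ?_⟩
  intro ρ hρ hρle Ω f hf
  set N := modNorm φ Ω 2 2 0 f ^ 2 with hN
  have hNt : N ≠ ∞ := (ENNReal.pow_lt_top hf).ne
  set a : ℕ → ℝ := fun k => ‖Ω.freq k‖ ^ (1 - α) with ha_def
  have ha : ∀ k, 0 < a k := fun k => rpow_norm_pos (Ω.freq_ne_zero k) _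
  set P : ℕ → 𝓢(𝔼, ℂ) := fun k => dualWindow α φ (Ω.freq k) (Ω.freq_ne_zero k) with hP
  have hsample : ∀ k, c₁ ≤ ‖Ω.freq k‖ →
      ENNReal.ofReal (a k ^ d) * ∫⁻ y, ‖f (translate y (P k))‖ₑ ^ 2 ≤
        4 * V * ∑' j, ‖f (translate (Ω.pos k j) (P k))‖ₑ ^ 2 := by
    intro k hk
    have hs := scale_pos (α := α) (Ω.freq k)
    set s := scale α (Ω.freq k) with hs_def
    have hL : 0 < a k * (ρ * s⁻¹) := by have := ha k; positivity
    have hLa : a k * (ρ * s⁻¹) / a k = ρ * s⁻¹ := mul_div_cancel_left₀ _ (ha k).ne'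
    have hLle : a k * (ρ * s⁻¹) ≤ L₀ := by
      calc a k * (ρ * s⁻¹) ≤ (q * s) * (ρ * s⁻¹) := by
            gcongr
            exact rpow_norm_le_scale hc₁ hc₁1 hk
        _ = q * ρ := by field_simp
        _ ≤ q * (L₀ / q) := by gcongr; exact hρle.trans (min_le_right _ _)
        _ = L₀ := mul_div_cancel₀ _ hq0.ne'
    have hL1 : a k * (ρ * s⁻¹) ≤ 1 := hLle.trans (min_le_left _ _)
    have hsmall : C * (a k * (ρ * s⁻¹)) * (1 + a k * (ρ * s⁻¹)) ^ e ≤ 1 / 2 := by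
      calc _ ≤ (C + 1) * (1 / (2 * (C + 1) * 2 ^ e)) * (1 + 1) ^ e := by
            gcongr
            · linarith
            · exact hLle.trans (min_le_right _ _)
        _ = 1 / 2 := by
            rw [one_add_one_eq_two]
            field_simp
    have h1 := (hS (a k) (ha k) _ hL.le _ _ (fourier_dualWindow_support (α := α) hφ
      (Ω.freq k) (Ω.freq_ne_zero k)) f).2 hsmall (Ω.pos k) (by rw [hLa]; exact Ω.pos_cover k)
    have h2 := volume_closedBall_mul_pow (d := d) (div_pos hL (ha k)).le (a k)
    rw [div_mul_cancel₀ _ (ha k).ne'] at h2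
    calc _ ≤ ENNReal.ofReal (a k ^ d) * _ := mul_le_mul' le_rfl h1
      _ = 4 * (volume (Metric.closedBall (0 : 𝔼) (a k * (ρ * s⁻¹) / a k)) *
          ENNReal.ofReal (a k ^ d)) * ∑' j, ‖f (translate (Ω.pos k j) (P k))‖ₑ ^ 2 := by ring
      _ ≤ _ := by
        rw [h2]
        gcongr
        refine mul_le_of_le_one_left zero_le (ENNReal.ofReal_le_one.2 ?_)
        exact pow_le_one₀ hL.le hL1
  have hbound : ∀ g : 𝓢(𝔼, ℂ), HasCompactSupport (𝓕 g : 𝓢(𝔼, ℂ)) →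
      ‖f g‖ ^ 2 ≤ 4 * V.toReal / (c / 2) ^ 2 * N.toReal * ‖g.toLp 2‖ ^ 2 := by
    intro g hg
    obtain ⟨T, hTgood, hT⟩ := Ω.exists_finset_cover φ (c₁ := c₁) hc (fun η => by
      obtain ⟨k, hk, hk'⟩ := hcov ρ hρ (hρle.trans (min_le_left _ _)) Ω.freq Ω.freq_cover
        ((2 * Real.pi) • η)
      refine ⟨k, hk, ?_⟩
      rwa [smul_comm, smul_sub, smul_smul, inv_mul_cancel₀ hpi.ne', one_smul] at hk') hg
    have h1 := enorm_apply_sq_le f P (fun k => pow_pos (ha k) d) T (by positivity) hg hT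
    have h2 : ∑ k ∈ T, ENNReal.ofReal (a k ^ d) * ∫⁻ y, ‖f (translate y (P k))‖ₑ ^ 2 ≤
        4 * V * N := by
      refine (Finset.sum_le_sum fun k hk => hsample k (hTgood k hk)).trans ?_
      rw [← Finset.mul_sum, hN, modNorm_sq]
      gcongr
      exact ENNReal.sum_le_tsum T
    have h3 := h1.trans (mul_le_mul' le_rfl h2)
    rw [← enorm_toLp_sq] at h3
    have h4 : ((ENNReal.ofReal ((c / 2) ^ 2))⁻¹ * ‖g.toLp 2‖ₑ ^ 2 * (4 * V * N)) ≠ ∞ := by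
      refine ENNReal.mul_ne_top (ENNReal.mul_ne_top (ENNReal.inv_ne_top.2 ?_)
        (ENNReal.pow_ne_top (by simp))) (ENNReal.mul_ne_top (ENNReal.mul_ne_top (by simp) hVt.ne)
        hNt)
      simp only [ne_eq, ENNReal.ofReal_eq_zero, not_le]
      positivity
    have h5 := ENNReal.toReal_mono h4 h3
    simp only [ENNReal.toReal_mul, ENNReal.toReal_pow, ENNReal.toReal_inv, toReal_enorm,
      ENNReal.toReal_ofReal (sq_nonneg (c / 2)), ENNReal.toReal_ofNat] at h5
    refine h5.trans (le_of_eq ?_)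
    field_simp
  have hD : 0 ≤ 4 * V.toReal / (c / 2) ^ 2 * N.toReal := by positivity
  obtain ⟨f₀, hf₀, hf₀f⟩ := exists_lp_of_bound f (Real.sqrt_nonneg _) fun g hg => by
    have h1 := Real.sqrt_le_sqrt (hbound g hg)
    rwa [Real.sqrt_sq (norm_nonneg _), Real.sqrt_mul hD, Real.sqrt_sq (norm_nonneg _)] at h1
  refine ⟨f₀, hf₀f, ?_⟩
  rw [← Real.sq_sqrt hD]
  exact pow_le_pow_left₀ (norm_nonneg _) hf₀ 2

theorem IsWindow.exists_frequency {φ : 𝓢(𝔼, ℂ)} (hφ : IsWindow φ) :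
    ∃ R : ℝ, 0 < R ∧ (∀ ζ, 𝓕 φ ζ ≠ 0 → ‖ζ‖ ≤ R) ∧ ∃ ζ₀ : 𝔼, ζ₀ ≠ 0 ∧ 𝓕 φ ζ₀ ≠ 0 := by
  obtain ⟨R₁, R₂, h1, h12, h⟩ := hφ.annulus
  obtain ⟨ζ₀, hζ⟩ : ∃ ζ, 𝓕 φ ζ ≠ 0 := by
    by_contra! h0
    refine hφ.ne_zero (schwartz_fourier_injective ?_)
    ext ζ
    rw [h0, FourierTransform.fourier_zero]
    rfl
  exact ⟨R₂, h1.trans h12, fun ζ hζ => (h ζ hζ).2, ζ₀,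
    norm_pos_iff.1 (h1.trans_le (h ζ₀ hζ).1), hζ⟩

end Frame

end Subdyadic

end

/-! ### The proposition -/

theorem proposition4p8 (d : ℕ) (α : ℝ) (hα : 0 < α)
    (φ : 𝓢(EuclideanSpace ℝ (Fin d), ℂ)) (hφ : Subdyadic.IsWindow φ) :
    ∃ ρ₀ : ℝ, 0 < ρ₀ ∧ ∀ ρ : ℝ, 0 < ρ → ρ ≤ ρ₀ → ∀ Ω : Subdyadic.Lattice d α ρ,
      Subdyadic.modSpace φ Ω 2 2 0 =
        Set.range (fun f : Lp ℂ 2 (volume : Measure (EuclideanSpace ℝ (Fin d))) =>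
          (f : 𝓢'(EuclideanSpace ℝ (Fin d), ℂ))) ∧
      ∃ A B : ℝ, 0 < A ∧ A ≤ B ∧
        ∀ f : Lp ℂ 2 (volume : Measure (EuclideanSpace ℝ (Fin d))),
          ENNReal.ofReal (A * ‖f‖ ^ 2) ≤
              Subdyadic.modNorm φ Ω 2 2 0 (f : 𝓢'(EuclideanSpace ℝ (Fin d), ℂ)) ^ 2 ∧
            Subdyadic.modNorm φ Ω 2 2 0 (f : 𝓢'(EuclideanSpace ℝ (Fin d), ℂ)) ^ 2 ≤
              ENNReal.ofReal (B * ‖f‖ ^ 2) := by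
  obtain ⟨R, hR, hφR, ζ₀, hζ₀, hφζ⟩ := hφ.exists_frequency
  obtain ⟨ρ₀, hρ₀, D, hD, hlow⟩ := Subdyadic.exists_le_modNorm hR hφR hα hζ₀ hφζ
  refine ⟨ρ₀, hρ₀, fun ρ hρ hρle Ω => ?_⟩
  obtain ⟨B, hB, hup⟩ := Subdyadic.exists_modNorm_le hR hφR hα hρ Ω
  have hfin : ∀ f : Lp ℂ 2 (volume : Measure (EuclideanSpace ℝ (Fin d))),
      Subdyadic.modNorm φ Ω 2 2 0 (f : 𝓢'(EuclideanSpace ℝ (Fin d), ℂ)) < ∞ := fun f => by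
    have h1 := (hup f).trans_lt (ENNReal.mul_lt_top hB (ENNReal.pow_lt_top (by simp)))
    by_contra h2
    rw [not_lt, top_le_iff] at h2
    simp [h2] at h1
  refine ⟨?_, D⁻¹, max D⁻¹ B.toReal, inv_pos.2 hD, le_max_left _ _, fun f => ⟨?_, ?_⟩⟩
  · ext f
    constructor
    · intro hf
      obtain ⟨f₀, hf₀, -⟩ := hlow ρ hρ hρle Ω f hf
      exact ⟨f₀, hf₀⟩
    · rintro ⟨f₀, rfl⟩
      exact hfin f₀
  · obtain ⟨f₀, hf₀, hle⟩ := hlow ρ hρ hρle Ω _ (hfin f)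
    -- The lower bound speaks of the `L²` function recovered from the distribution; it is the
    -- original one because `L²` embeds injectively.
    have hinj : f₀ = f := LinearMap.ker_eq_bot.1 (Lp.ker_toTemperedDistributionCLM_eq_bot (F := ℂ)
      (μ := (volume : Measure (EuclideanSpace ℝ (Fin d)))) (p := 2)) hf₀
    rw [hinj] at hle
    refine ENNReal.ofReal_le_of_le_toReal ?_
    rwa [inv_mul_le_iff₀ hD]
  · refine (hup f).trans ?_
    rw [← ENNReal.ofReal_toReal hB.ne, ← ofReal_norm, ← ENNReal.ofReal_pow (norm_nonneg _),
      ← ENNReal.ofReal_mul ENNReal.toReal_nonneg, ENNReal.ofReal_toReal hB.ne]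
    gcongr
    exact le_max_right _ _
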